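/- Let $n\ge 3$, let $(M,g)$ be a connected smooth $n$-dimensional Riemannian manifold (without boundary), and let $r$, $s$ and $z=r-\frac sn g$ denote its Ricci, scalar and traceless Ricci curvature. Curvature signs are such that $R(X,Y,X,Y)$ is the sectional curvature of an orthonormal pair, and the Weyl tensor $\mathcal W$ is given by $R=\frac{s}{2n(n-1)}\,g\owedge g+\frac1{n-2}\,z\owedge g+\mathcal W$, where $\owedge$ is the Kulkarni–Nomizu product. For a $1$-form $\phi$ and a symmetric $2$-tensor $\eta$ put $(\phi\wedge\eta)(X,Y,Z)=\phi(X)\eta(Y,Z)-\phi(Y)\eta(X,Z)$. Suppose that $(M,g,f)$ is a vacuum static space, i.e. $f:M\to\mathbb R$ is a smooth function, not identically zero, with $$Ddf-\Bigl(r-\frac{s}{n-1}\,g\Bigr)f=0 .$$ Let $$C(X,Y,Z)=(D_Xr)(Y,Z)-(D_Yr)(X,Z)-\frac1{2(n-1)}\,(ds\wedge g)(X,Y,Z)$$ be the Cotton tensor, let $$B(X,Y)=\frac1{n-3}\sum_{k,l}(D^2_{E_k,E_l}\mathcal W)(X,E_k,Y,E_l)+\frac1{n-2}\sum_{k,l}\mathcal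 W(X,E_k,Y,E_l)\,r(E_k,E_l)$$ be the Bach tensor, where $\{E_i\}$ is an orthonormal frame (for $n=3$, where $\mathcal W=0$, $B(X,Y)=\sum_i (D_{E_i}C)(E_i,X,Y)$), and let $$T=\frac1{n-2}\,df\wedge z+\frac1{(n-1)(n-2)}\,z(\nabla f,\cdot)\wedge g .$$ Assume that the complete divergence of the Bach tensor vanishes: $\operatorname{div}^2B=\sum_{i,j}(D^2_{E_i,E_j}B)(E_j,E_i)=0$ on $M$. If $T=0$ on $M$, then $B=0$ and $C=0$ on $M$. -/

import Mathlib

open scoped Manifold ContDiff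

noncomputable section

namespace StaticSpace

/-! ### Riemannian geometry in local coordinates

`G` is the matrix `(g_ij)` of a metric in a coordinate system, as a function on (an open part of)
`ℝⁿ`; all tensors are covariant and given by their components. -/

/-- The coordinate space `ℝⁿ`. -/
abbrev Coord (n : ℕ) : Type := EuclideanSpace ℝ (Fin n)

/-- A matrix field on the coordinate space: the components `g_ij` of a metric. -/
abbrev CoordMetric (n : ℕ) : Type := Coord n → Matrix (Fin n) (Fin n) ℝ

section Local

variable {n : ℕ}

/-- The partial derivative `∂_i F`. -/
def pd (i : Fin n) (F : Coord n → ℝ) (y : Coord n) : ℝ :=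
  fderiv ℝ F y (EuclideanSpace.single i 1)

/-- The components `g^{ij}` of the inverse metric. -/
def ginv (G : CoordMetric n) (i j : Fin n) (y : Coord n) : ℝ :=
  (G y)⁻¹ i j

/-- The Christoffel symbols `Γ^k_{ij}` of the Levi-Civita connection. -/
def christoffel (G : CoordMetric n) (k i j : Fin n) (y : Coord n) : ℝ :=
  (1 / 2) * ∑ l, ginv G k l y *
    (pd i (fun x => G x j l) y + pd j (fun x => G x i l) y - pd l (fun x => G x i j) y)

/-- `D_i φ_j`, the covariant derivative of a `1`-form. -/
def cov1 (G : CoordMetric n) (φ : Fin n → Coord n → ℝ) (i j : Fin n) (y : Coord n) : ℝ :=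
  pd i (φ j) y - ∑ m, christoffel G m i j y * φ m y

/-- `D_i h_{jk}`, the covariant derivative of a `2`-tensor. -/
def cov2 (G : CoordMetric n) (h : Fin n → Fin n → Coord n → ℝ) (i j k : Fin n)
    (y : Coord n) : ℝ :=
  pd i (h j k) y
    - ∑ m, (christoffel G m i j y * h m k y + christoffel G m i k y * h j m y)

/-- `D_i A_{jkl}`, the covariant derivative of a `3`-tensor. -/
def cov3 (G : CoordMetric n) (A : Fin n → Fin n → Fin n → Coord n → ℝ) (i j k l : Fin n)
    (y : Coord n) : ℝ :=
  pd i (A j k l) y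
    - ∑ m, (christoffel G m i j y * A m k l y + christoffel G m i k y * A j m l y
        + christoffel G m i l y * A j k m y)

/-- `D_i Q_{jklp}`, the covariant derivative of a `4`-tensor. -/
def cov4 (G : CoordMetric n) (Q : Fin n → Fin n → Fin n → Fin n → Coord n → ℝ)
    (i j k l p : Fin n) (y : Coord n) : ℝ :=
  pd i (Q j k l p) y
    - ∑ m, (christoffel G m i j y * Q m k l p y + christoffel G m i k y * Q j m l p y
        + christoffel G m i l y * Q j k m p y + christoffel G m i p y * Q j k l m y)

/-- The Riemann tensor `R_{ijkl}`, with the sign for which `R(X, Y, X, Y)` is the sectional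
curvature of an orthonormal pair, i.e. `R(X, Y)Z = D_{[X,Y]} Z - [D_X, D_Y] Z`. -/
def riem (G : CoordMetric n) (i j k l : Fin n) (y : Coord n) : ℝ :=
  ∑ m, G y l m *
    (pd j (christoffel G m i k) y - pd i (christoffel G m j k) y
      + ∑ p, (christoffel G p i k y * christoffel G m j p y
          - christoffel G p j k y * christoffel G m i p y))

/-- The Ricci tensor `r_{jl} = g^{ik} R_{ijkl}`. -/
def ric (G : CoordMetric n) (j l : Fin n) (y : Coord n) : ℝ :=
  ∑ i, ∑ k, ginv G i k y * riem G i j k l y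

/-- The scalar curvature `s`. -/
def scal (G : CoordMetric n) (y : Coord n) : ℝ :=
  ∑ j, ∑ l, ginv G j l y * ric G j l y

/-- The traceless Ricci tensor `z = r - (s/n) g`. -/
def tracelessRic (G : CoordMetric n) (i j : Fin n) (y : Coord n) : ℝ :=
  ric G i j y - scal G y / (n : ℝ) * G y i j

/-- The Weyl tensor, from the decomposition
`R = s/(2n(n-1)) g ∧ g + 1/(n-2) z ∧ g + W` with the Kulkarni-Nomizu product. -/
def weyl (G : CoordMetric n) (i j k l : Fin n) (y : Coord n) : ℝ :=
  riem G i j k l y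
    - scal G y / ((n : ℝ) * ((n : ℝ) - 1)) * (G y i k * G y j l - G y i l * G y j k)
    - 1 / ((n : ℝ) - 2) *
      (tracelessRic G i k y * G y j l + tracelessRic G j l y * G y i k
        - tracelessRic G i l y * G y j k - tracelessRic G j k y * G y i l)

/-- The Cotton tensor `C = d^D r - 1/(2(n-1)) ds ∧ g`, where
`(φ ∧ η)(X, Y, Z) = φ(X) η(Y, Z) - φ(Y) η(X, Z)`. -/
def cotton (G : CoordMetric n) (i j k : Fin n) (y : Coord n) : ℝ :=
  cov2 G (ric G) i j k y - cov2 G (ric G) j i k y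
    - 1 / (2 * ((n : ℝ) - 1)) * (pd i (scal G) y * G y j k - pd j (scal G) y * G y i k)

/-- `(div C)(X, Y) = ∑ (D_{E_i} C)(E_i, X, Y)`. -/
def divCotton (G : CoordMetric n) (i j : Fin n) (y : Coord n) : ℝ :=
  ∑ k, ∑ l, ginv G k l y * cov3 G (cotton G) k l i j y

/-- The divergence of the Weyl tensor in its last slot, `∑ (D_{E_l} W)(X, Y, Z, E_l)`. -/
def divWeyl (G : CoordMetric n) (i j k : Fin n) (y : Coord n) : ℝ :=
  ∑ p, ∑ l, ginv G p l y * cov4 G (weyl G) p i j k l y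

/-- The double divergence of the Weyl tensor, `∑ (D²_{E_k, E_l} W)(X, E_k, Y, E_l)`. -/
def divDivWeyl (G : CoordMetric n) (i j : Fin n) (y : Coord n) : ℝ :=
  ∑ p, ∑ k, ginv G p k y * cov3 G (divWeyl G) p i k j y

/-- The contraction `∑ r(W(X, E_i)Y, E_i) = ∑ W(X, E_i, Y, E_j) r(E_i, E_j)`. -/
def weylRic (G : CoordMetric n) (i j : Fin n) (y : Coord n) : ℝ :=
  ∑ k, ∑ l, ∑ p, ∑ q, ginv G k p y * ginv G l q y * weyl G i k j l y * ric G p q y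

/-- The Bach tensor: for `n ≥ 4` it is `1/(n-3) div div W + 1/(n-2) W(r)`. In dimension three, where
the Weyl tensor vanishes and the first coefficient is meaningless, the double divergence term is
replaced as usual by `1/(n-2) div C`, to which it is equal for `n ≥ 4`. -/
def bach (G : CoordMetric n) (i j : Fin n) (y : Coord n) : ℝ :=
  (if n = 3 then 1 / ((n : ℝ) - 2) * divCotton G i j y
    else 1 / ((n : ℝ) - 3) * divDivWeyl G i j y)
  + 1 / ((n : ℝ) - 2) * weylRic G i j y

/-- The divergence of the Bach tensor. -/
def divBach (G : CoordMetric n) (j : Fin n) (y : Coord n) : ℝ :=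
  ∑ k, ∑ l, ginv G k l y * cov2 G (bach G) k l j y

/-- The complete divergence `div² B` of the Bach tensor. -/
def divDivBach (G : CoordMetric n) (y : Coord n) : ℝ :=
  ∑ k, ∑ l, ginv G k l y * cov1 G (divBach G) k l y

/-- The Hessian `Ddf`. -/
def hess (G : CoordMetric n) (u : Coord n → ℝ) (i j : Fin n) (y : Coord n) : ℝ :=
  cov1 G (fun k => pd k u) i j y

/-- The `1`-form `z(∇f, ·)`. -/
def gradTracelessRic (G : CoordMetric n) (u : Coord n → ℝ) (i : Fin n) (y : Coord n) : ℝ :=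
  ∑ a, ∑ b, ginv G a b y * pd a u y * tracelessRic G b i y

/-- The tensor `T = 1/(n-2) df ∧ z + 1/((n-1)(n-2)) z(∇f, ·) ∧ g`. -/
def tensorT (G : CoordMetric n) (u : Coord n → ℝ) (i j k : Fin n) (y : Coord n) : ℝ :=
  1 / ((n : ℝ) - 2) * (pd i u y * tracelessRic G j k y - pd j u y * tracelessRic G i k y)
    + 1 / (((n : ℝ) - 1) * ((n : ℝ) - 2)) *
      (gradTracelessRic G u i y * G y j k - gradTracelessRic G u j y * G y i k)

end Local

/-! ### Riemannian manifolds

A tensor field on `M` vanishes when its components vanish in every chart of the smooth structure,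
at every point of the chart. -/

section Global

variable {n : ℕ} {M : Type*} [TopologicalSpace M] [ChartedSpace (Coord n) M]
  [IsManifold (𝓡 n) ∞ M]

/-- Smooth Riemannian metrics on `M`. -/
abbrev Metric (n : ℕ) (M : Type*) [TopologicalSpace M] [ChartedSpace (Coord n) M]
    [IsManifold (𝓡 n) ∞ M] : Type _ :=
  Bundle.ContMDiffRiemannianMetric (𝓡 n) ∞ (Coord n) (fun x : M => TangentSpace (𝓡 n) x)

/-- The coordinate vector field `∂_i` of the chart `e`, at the point with coordinates `y`. -/
def coordVec (e : OpenPartialHomeomorph M (Coord n)) (i : Fin n) (y : Coord n) :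
    TangentSpace (𝓡 n) (e.symm y) :=
  mfderiv (𝓡 n) (𝓡 n) e.symm y (EuclideanSpace.single i 1 : Coord n)

/-- The components `g(∂_i, ∂_j)` of the metric in the chart `e`. -/
def metricIn (g : Metric n M) (e : OpenPartialHomeomorph M (Coord n)) : CoordMetric n :=
  fun y => Matrix.of fun i j => g.inner (e.symm y) (coordVec e i y) (coordVec e j y)

/-- The function `f` in the chart `e`. -/
def funIn (f : M → ℝ) (e : OpenPartialHomeomorph M (Coord n)) : Coord n → ℝ :=
  fun y => f (e.symm y)

/-- `(M, g, f)` is a vacuum static space: `f` is smooth, not identically zero, and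
`Ddf - (r - s/(n-1) g) f = 0`. -/
structure IsVacuumStatic (g : Metric n M) (f : M → ℝ) : Prop where
  smooth : ContMDiff (𝓡 n) 𝓘(ℝ, ℝ) ∞ f
  nontrivial : ∃ x, f x ≠ 0
  static : ∀ e ∈ IsManifold.maximalAtlas (𝓡 n) ∞ M, ∀ y ∈ e.target, ∀ i j,
    hess (metricIn g e) (funIn f e) i j y
      - (ric (metricIn g e) i j y - scal (metricIn g e) y / ((n : ℝ) - 1) * metricIn g e y i j)
        * funIn f e y = 0

/-- `T = 0` on `M`. -/
def TensorTVanishes (g : Metric n M) (f : M → ℝ) : Prop :=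
  ∀ e ∈ IsManifold.maximalAtlas (𝓡 n) ∞ M, ∀ y ∈ e.target, ∀ i j k,
    tensorT (metricIn g e) (funIn f e) i j k y = 0

/-- `C = 0` on `M`. -/
def CottonVanishes (g : Metric n M) : Prop :=
  ∀ e ∈ IsManifold.maximalAtlas (𝓡 n) ∞ M, ∀ y ∈ e.target, ∀ i j k,
    cotton (metricIn g e) i j k y = 0

/-- `B = 0` on `M`. -/
def BachVanishes (g : Metric n M) : Prop :=
  ∀ e ∈ IsManifold.maximalAtlas (𝓡 n) ∞ M, ∀ y ∈ e.target, ∀ i j,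
    bach (metricIn g e) i j y = 0

/-- `div² B = 0` on `M`. -/
def DivDivBachVanishes (g : Metric n M) : Prop :=
  ∀ e ∈ IsManifold.maximalAtlas (𝓡 n) ∞ M, ∀ y ∈ e.target,
    divDivBach (metricIn g e) y = 0

end Global

end StaticSpace

end

/-!
Where neither `f` nor `df` vanishes, `T = 0` determines `z`, and hence the Ricci tensor, as a
combination of `df ⊗ df` and `g`. By the static equation the Hessian of `f` has the same shape, so
`C(X, Y, Z)` is the sum of `df(Z)` times a `2`-form divisible by `df` and of the wedge product of a
`1`-form with `g`. The Ricci identity for `df` gives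
`W(X, Y, Z, ∇f) = f C(X, Y, Z) + (n - 1) T(X, Y, Z)`, and with `T = 0` this shows `C(X, Y, ∇f) = 0`.
As `C` is also trace-free, it vanishes, and then so do `W(X, Y, Z, ∇f)` and the contraction `W(r)`
of `W` with the Ricci tensor. Where `f` is a nonzero constant on an open set, the trace of the
static equation makes `g` Ricci-flat there.

The `1`-jet of `f` solves a linear first-order system along segments, so `f` cannot vanish on an
open set, and `C = 0`, `W(r) = 0` hold everywhere by continuity. Finally
`(n - 2) div W = -(n - 3) C`, so only `W(r)` is left in the Bach tensor.
-/

namespace StaticSpace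

open Filter Topology Matrix Bundle

/-! ### Traces and inner products with respect to a metric -/

section MetricAlgebra

variable {ι : Type*} [Fintype ι] [DecidableEq ι] {g : Matrix ι ι ℝ}

/-- The trace `g^{kl} A_{kl}` of a `2`-tensor with respect to the metric `g`. -/
noncomputable def metricTrace (g : Matrix ι ι ℝ) (A : ι → ι → ℝ) : ℝ :=
  ∑ k, ∑ l, g⁻¹ k l * A k l

/-- The inner product `g^{kl} φ_k ψ_l` of two covectors. For `φ = du` it is the value `ψ(∇u)`, which
is how contractions with a gradient are written below. -/
noncomputable def coinner (g : Matrix ι ι ℝ) (φ ψ : ι → ℝ) : ℝ :=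
  metricTrace g fun k l => φ k * ψ l

/-- The inner product `g^{kp} g^{lq} A_{kl} B_{pq}` of two `2`-tensors. -/
noncomputable def tensorInner (g : Matrix ι ι ℝ) (A B : ι → ι → ℝ) : ℝ :=
  metricTrace g fun k p => metricTrace g fun l q => A k l * B p q

/-- The Kulkarni-Nomizu product of two symmetric `2`-tensors. -/
def kulkarniNomizu (A B : ι → ι → ℝ) (i j k l : ι) : ℝ :=
  A i k * B j l + A j l * B i k - A i l * B j k - A j k * B i l

theorem metricTrace_add (g : Matrix ι ι ℝ) (A B : ι → ι → ℝ) :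
    metricTrace g (fun k l => A k l + B k l) = metricTrace g A + metricTrace g B := by
  simp only [metricTrace, mul_add, Finset.sum_add_distrib]

theorem metricTrace_sub (g : Matrix ι ι ℝ) (A B : ι → ι → ℝ) :
    metricTrace g (fun k l => A k l - B k l) = metricTrace g A - metricTrace g B := by
  simp only [metricTrace, mul_sub, Finset.sum_sub_distrib]

theorem metricTrace_const_mul (g : Matrix ι ι ℝ) (c : ℝ) (A : ι → ι → ℝ) :
    metricTrace g (fun k l => c * A k l) = c * metricTrace g A := by
  simp only [metricTrace, mul_left_comm _ c, Finset.mul_sum]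

theorem metricTrace_neg (g : Matrix ι ι ℝ) (A : ι → ι → ℝ) :
    metricTrace g (fun k l => -A k l) = -metricTrace g A := by
  simp only [metricTrace, mul_neg, Finset.sum_neg_distrib]

theorem metricTrace_sum {κ : Type*} (s : Finset κ) (g : Matrix ι ι ℝ) (A : κ → ι → ι → ℝ) :
    metricTrace g (fun k l => ∑ m ∈ s, A m k l) = ∑ m ∈ s, metricTrace g (A m) := by
  simp only [metricTrace, Finset.mul_sum]
  exact (Finset.sum_congr rfl fun _ _ => Finset.sum_comm).trans Finset.sum_comm

theorem metricTrace_eq_trace (hg : g.IsSymm) (A : Matrix ι ι ℝ) :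
    metricTrace g A = (g⁻¹ * A).trace := by
  simp only [metricTrace, trace, diag, mul_apply]
  rw [Finset.sum_comm]
  exact Finset.sum_congr rfl fun l _ => Finset.sum_congr rfl fun k _ => by rw [hg.inv.apply]

theorem metricTrace_swap (hg : g.IsSymm) (A : ι → ι → ℝ) :
    metricTrace g (fun k l => A l k) = metricTrace g A := by
  rw [metricTrace, Finset.sum_comm]
  exact Finset.sum_congr rfl fun l _ => Finset.sum_congr rfl fun k _ => by rw [hg.inv.apply]

theorem metricTrace_comm (g : Matrix ι ι ℝ) (A : ι → ι → ι → ι → ℝ) :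
    metricTrace g (fun i j => metricTrace g fun k l => A i j k l)
      = metricTrace g fun k l => metricTrace g fun i j => A i j k l := by
  calc metricTrace g (fun i j => ∑ k, ∑ l, g⁻¹ k l * A i j k l)
      = ∑ k, ∑ l, metricTrace g fun i j => g⁻¹ k l * A i j k l := by simp only [metricTrace_sum]
    _ = ∑ k, ∑ l, g⁻¹ k l * metricTrace g fun i j => A i j k l := by
        simp only [metricTrace_const_mul]

theorem metricTrace_mul_metric (hdet : IsUnit g.det) (X : ι → ℝ) (j : ι) :
    metricTrace g (fun k l => X k * g l j) = X j := by
  have inv_mul (k : ι) : ∑ l, g⁻¹ k l * g l j = if k = j then 1 else 0 := by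
    rw [← mul_apply, nonsing_inv_mul g hdet, one_apply]
  simp only [metricTrace, mul_left_comm _ (X _), ← Finset.mul_sum, inv_mul]
  simp

theorem metricTrace_metric (hg : g.IsSymm) (hdet : IsUnit g.det) :
    metricTrace g g = Fintype.card ι := by
  rw [metricTrace_eq_trace hg, nonsing_inv_mul g hdet, trace_one]

theorem metricTrace_kulkarniNomizu (hg : g.IsSymm) (hdet : IsUnit g.det) (A : ι → ι → ℝ)
    (i j : ι) :
    metricTrace g (fun k l => kulkarniNomizu A g i k j l)
      = (Fintype.card ι - 2) * A i j + metricTrace g A * g i j := by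
  have expand (k l : ι) : kulkarniNomizu A g i k j l
      = A i j * g k l + g i j * A k l - A i l * g k j - A k j * g l i := by
    rw [hg.apply i l]
    simp only [kulkarniNomizu]
    ring
  have swapped : metricTrace g (fun k l => A i l * g k j) = A i j := by
    rw [← metricTrace_swap hg, metricTrace_mul_metric hdet (A i)]
  have trace_metric : metricTrace g (fun k l => A i j * g k l) = A i j * Fintype.card ι := by
    rw [metricTrace_const_mul g (A i j) g, metricTrace_metric hg hdet]
  simp only [expand, metricTrace_add, metricTrace_sub, trace_metric, swapped,
    metricTrace_mul_metric hdet fun k => A k j]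
  rw [metricTrace_const_mul g (g i j) A]
  ring

theorem coinner_add (g : Matrix ι ι ℝ) (φ ψ χ : ι → ℝ) :
    coinner g φ (fun l => ψ l + χ l) = coinner g φ ψ + coinner g φ χ := by
  simp only [coinner, mul_add, metricTrace_add]

theorem coinner_sub (g : Matrix ι ι ℝ) (φ ψ χ : ι → ℝ) :
    coinner g φ (fun l => ψ l - χ l) = coinner g φ ψ - coinner g φ χ := by
  simp only [coinner, mul_sub, metricTrace_sub]

theorem coinner_const_mul (g : Matrix ι ι ℝ) (φ : ι → ℝ) (c : ℝ) (ψ : ι → ℝ) :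
    coinner g φ (fun l => c * ψ l) = c * coinner g φ ψ := by
  simp only [coinner, mul_left_comm _ c, metricTrace_const_mul]

theorem coinner_zero (g : Matrix ι ι ℝ) (φ : ι → ℝ) : coinner g φ (fun _ => 0) = 0 := by
  simp [coinner, metricTrace]

theorem coinner_comm (hg : g.IsSymm) (φ ψ : ι → ℝ) : coinner g φ ψ = coinner g ψ φ := by
  rw [coinner, ← metricTrace_swap hg]
  simp only [coinner, mul_comm]

theorem coinner_metric (hdet : IsUnit g.det) (φ : ι → ℝ) (j : ι) :
    coinner g φ (fun l => g l j) = φ j :=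
  metricTrace_mul_metric hdet φ j

theorem coinner_mulVec (hdet : IsUnit g.det) (φ X : ι → ℝ) : coinner g φ (g *ᵥ X) = φ ⬝ᵥ X := by
  have : coinner g φ (g *ᵥ X) = φ ⬝ᵥ g⁻¹ *ᵥ (g *ᵥ X) := by
    simp only [coinner, metricTrace, dotProduct, mulVec, Finset.mul_sum]
    exact Finset.sum_congr rfl fun k _ => Finset.sum_congr rfl fun l _ =>
      Finset.sum_congr rfl fun m _ => by ring
  rw [this, mulVec_mulVec, nonsing_inv_mul g hdet, one_mulVec]

theorem coinner_self_pos (hg : g.PosDef) {φ : ι → ℝ} (hφ : φ ≠ 0) : 0 < coinner g φ φ := by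
  refine (hg.inv.dotProduct_mulVec_pos hφ).trans_eq ?_
  simp only [coinner, metricTrace, dotProduct, mulVec, Finset.mul_sum, star_trivial]
  exact Finset.sum_congr rfl fun k _ => Finset.sum_congr rfl fun l _ => mul_left_comm _ _ _

theorem coinner_coinner_eq_zero_of_antisymm (g : Matrix ι ι ℝ) (φ : ι → ℝ) {A : ι → ι → ℝ}
    (hA : ∀ k l, A k l = -A l k) : coinner g φ (fun k => coinner g φ (A k)) = 0 := by
  have expand (B : ι → ι → ℝ) : coinner g φ (fun k => coinner g φ (B k))
      = metricTrace g fun a k => metricTrace g fun b l => φ a * (φ b * B k l) := by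
    simp only [coinner, metricTrace_const_mul]
  have swapped : coinner g φ (fun k => coinner g φ (A k))
      = coinner g φ (fun k => coinner g φ fun l => A l k) := by
    rw [expand, expand, metricTrace_comm]
    simp only [mul_left_comm (φ _) (φ _)]
  have negated : coinner g φ (fun k => coinner g φ (A k))
      = -coinner g φ (fun k => coinner g φ fun l => A l k) := by
    conv_lhs => rw [show A = fun k l => -A l k from funext₂ hA]
    simp only [coinner, mul_neg, metricTrace_neg]
  linarith

theorem tensorInner_add (g : Matrix ι ι ℝ) (A B C : ι → ι → ℝ) :
    tensorInner g A (fun p q => B p q + C p q) = tensorInner g A B + tensorInner g A C := by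
  simp only [tensorInner, mul_add, metricTrace_add]

theorem tensorInner_const_mul (g : Matrix ι ι ℝ) (A : ι → ι → ℝ) (c : ℝ) (B : ι → ι → ℝ) :
    tensorInner g A (fun p q => c * B p q) = c * tensorInner g A B := by
  simp only [tensorInner, mul_left_comm _ c, metricTrace_const_mul]

theorem tensorInner_metric (hg : g.IsSymm) (hdet : IsUnit g.det) (A : ι → ι → ℝ) :
    tensorInner g A g = metricTrace g A := by
  have (k p : ι) : metricTrace g (fun l q => A k l * g p q) = A k p := by
    simp only [← metricTrace_mul_metric hdet (A k) p, hg.apply p]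
  simp only [tensorInner, this]

theorem tensorInner_mul_self (hg : g.IsSymm) (A : ι → ι → ℝ) (φ : ι → ℝ) :
    tensorInner g A (fun p q => φ p * φ q) = coinner g φ (fun k => coinner g φ (A k)) := by
  rw [coinner_comm hg]
  simp only [tensorInner, coinner_comm hg φ (A _), mul_left_comm _ (φ _), metricTrace_const_mul]
  simp only [coinner, mul_comm (φ _)]

theorem eq_of_wedge_add_wedge_eq_zero (hg : g.IsSymm) (hdet : IsUnit g.det) {p q : ι → ℝ}
    {z : ι → ι → ℝ} {c : ℝ} (hc : c ≠ 1) (hp : coinner g p p ≠ 0) (hsymm : ∀ i j, z i j = z j i)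
    (hq : ∀ j, coinner g p (fun i => z i j) = q j)
    (hz : ∀ i j k, p i * z j k - p j * z i k + c * (q i * g j k - q j * g i k) = 0) (j k : ι) :
    z j k = ((1 + c) * coinner g p q / coinner g p p ^ 2) * (p j * p k)
      + -(c * coinner g p q / coinner g p p) * g j k := by
  have contract_first (j k : ι) : z j k * coinner g p p - p j * q k
      + c * (g j k * coinner g p q - q j * p k) = 0 := by
    have := congrArg (coinner g p) (funext fun i => show
      z j k * p i - p j * z i k + c * (g j k * q i - q j * g i k) = 0 by
        linear_combination hz i j k)
    simpa only [coinner_add, coinner_sub, coinner_const_mul, hq, coinner_metric hdet,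
      coinner_zero] using this
  have contract_last (j : ι) : coinner g p p * q j - p j * coinner g p q
      + c * (coinner g p q * p j - q j * coinner g p p) = 0 := by
    have := congrArg (coinner g p) (funext fun k => show
      coinner g p p * z k j - p j * q k + c * (coinner g p q * g k j - q j * p k) = 0 by
        rw [hsymm k j, hg.apply j k]
        linear_combination contract_first j k)
    simpa only [coinner_add, coinner_sub, coinner_const_mul, hq, coinner_metric hdet,
      coinner_zero] using this
  have parallel (j : ι) : q j = coinner g p q / coinner g p p * p j := by
    rw [div_mul_eq_mul_div, eq_div_iff hp]
    exact mul_left_cancel₀ (sub_ne_zero.mpr hc.symm) (by linear_combination contract_last j)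
  have := contract_first j k
  rw [parallel j, parallel k] at this
  field_simp at this ⊢
  linear_combination this

theorem eq_zero_of_wedge_mul_add_wedge_metric (hg : g.IsSymm) (hdet : IsUnit g.det)
    (hcard₁ : (Fintype.card ι : ℝ) ≠ 1) (hcard₂ : (Fintype.card ι : ℝ) ≠ 2) {α μ p : ι → ℝ}
    {C : ι → ι → ι → ℝ} (hp : coinner g p p ≠ 0)
    (hC : ∀ i j k, C i j k = p k * (α i * p j - α j * p i) + (μ i * g j k - μ j * g i k))
    (htrace : ∀ i, metricTrace g (C i) = 0) (hgrad : ∀ i j, coinner g p (C i j) = 0)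
    (i j k : ι) : C i j k = 0 := by
  have contract_trace (i : ι) : α i * coinner g p p - p i * coinner g α p
      + (μ i * Fintype.card ι - μ i) = 0 := by
    have expand : C i = fun j k => α i * (p j * p k) - p i * (α j * p k)
        + (μ i * g j k - μ j * g k i) := by
      funext j k
      rw [hC, hg.apply k i]
      ring
    rw [← htrace i, expand]
    simp only [metricTrace_add, metricTrace_sub, metricTrace_const_mul,
      metricTrace_const_mul g (μ i) g, metricTrace_metric hg hdet, metricTrace_mul_metric hdet,
      coinner]
  have contract_last (i j : ι) : (α i * p j - α j * p i) * coinner g p p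
      + (μ i * p j - μ j * p i) = 0 := by
    have expand : C i j = fun k => (α i * p j - α j * p i) * p k
        + (μ i * g k j - μ j * g k i) := by
      funext k
      rw [hC, hg.apply k i, hg.apply k j]
      ring
    rw [← hgrad i j, expand]
    simp only [coinner_add, coinner_sub, coinner_const_mul, coinner_metric hdet]
  have μ_parallel (i j : ι) : μ i * p j - μ j * p i = 0 :=
    (mul_eq_zero.mp (show (Fintype.card ι - 2 : ℝ) * _ = 0 by
      linear_combination p j * contract_trace i - p i * contract_trace j
        - contract_last i j)).resolve_left (sub_ne_zero.mpr hcard₂)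
  have α_parallel (i j : ι) : α i * p j - α j * p i = 0 :=
    (mul_eq_zero.mp (show _ * coinner g p p = 0 by
      linear_combination contract_last i j - μ_parallel i j)).resolve_right hp
  have α_eq (i : ι) : α i * coinner g p p - p i * coinner g α p = 0 := by
    rw [coinner_comm hg α p, ← coinner_const_mul, ← coinner_const_mul, ← coinner_sub,
      ← coinner_zero g p]
    congr 1
    funext j
    linear_combination α_parallel i j
  have μ_eq (i : ι) : μ i = 0 :=
    (mul_eq_zero.mp (show _ * (Fintype.card ι - 1 : ℝ) = 0 by
      linear_combination contract_trace i - α_eq i)).resolve_right (sub_ne_zero.mpr hcard₁)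
  rw [hC, α_parallel, μ_eq, μ_eq]
  ring

end MetricAlgebra

variable {n : ℕ} {U : Set (Coord n)} {y : Coord n} {G : CoordMetric n} {u : Coord n → ℝ}

/-! ### Partial derivatives -/

/-- Smoothness on a set, for scalar functions of the coordinates. -/
abbrev SmoothOn (U : Set (Coord n)) (F : Coord n → ℝ) : Prop := ContDiffOn ℝ ∞ F U

section Partial

variable {F H : Coord n → ℝ}

theorem pd_congr (hU : IsOpen U) (h : Set.EqOn F H U) (hy : y ∈ U) (i : Fin n) :
    pd i F y = pd i H y := by
  simp only [pd, (h.eventuallyEq_of_mem (hU.mem_nhds hy)).fderiv_eq]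

theorem pd_const (i : Fin n) (c : ℝ) (y : Coord n) : pd i (fun _ => c) y = 0 := by
  simp [pd]

theorem pd_neg (i : Fin n) (F : Coord n → ℝ) (y : Coord n) :
    pd i (fun x => -F x) y = -pd i F y := by
  simp [pd]

theorem pd_add (i : Fin n) (hF : DifferentiableAt ℝ F y) (hH : DifferentiableAt ℝ H y) :
    pd i (fun x => F x + H x) y = pd i F y + pd i H y := by
  simp [pd, fderiv_fun_add hF hH]

theorem pd_sub (i : Fin n) (hF : DifferentiableAt ℝ F y) (hH : DifferentiableAt ℝ H y) :
    pd i (fun x => F x - H x) y = pd i F y - pd i H y := by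
  simp [pd, fderiv_fun_sub hF hH]

theorem pd_mul (i : Fin n) (hF : DifferentiableAt ℝ F y) (hH : DifferentiableAt ℝ H y) :
    pd i (fun x => F x * H x) y = pd i F y * H y + F y * pd i H y := by
  simp only [pd, fderiv_fun_mul hF hH, _root_.add_apply, _root_.smul_apply, smul_eq_mul]
  ring

theorem pd_const_mul (i : Fin n) (c : ℝ) (hF : DifferentiableAt ℝ F y) :
    pd i (fun x => c * F x) y = c * pd i F y := by
  rw [pd_mul i (differentiableAt_const c) hF, pd_const, zero_mul, zero_add]

theorem pd_sum {ι : Type*} (s : Finset ι) {F : ι → Coord n → ℝ} (i : Fin n)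
    (hF : ∀ k, DifferentiableAt ℝ (F k) y) :
    pd i (fun x => ∑ k ∈ s, F k x) y = ∑ k ∈ s, pd i (F k) y := by
  simp [pd, fderiv_fun_sum (fun k _ => hF k)]

theorem SmoothOn.differentiableAt (h : SmoothOn U F) (hU : IsOpen U) (hy : y ∈ U) :
    DifferentiableAt ℝ F y :=
  (h.contDiffAt (hU.mem_nhds hy)).differentiableAt (by simp)

theorem SmoothOn.pd_of_isOpen (h : SmoothOn U F) (hU : IsOpen U) (i : Fin n) :
    SmoothOn U (pd i F) :=
  (h.fderiv_of_isOpen hU (m := ∞) (by simp)).clm_apply contDiffOn_const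

theorem SmoothOn.sum {ι : Type*} {s : Finset ι} {F : ι → Coord n → ℝ}
    (h : ∀ k, SmoothOn U (F k)) : SmoothOn U (fun x => ∑ k ∈ s, F k x) :=
  ContDiffOn.sum fun k _ => h k

theorem pd_comm (h : SmoothOn U F) (hU : IsOpen U) (hy : y ∈ U) (i j : Fin n) :
    pd i (pd j F) y = pd j (pd i F) y := by
  have hsymm : IsSymmSndFDerivAt ℝ F y :=
    (h.contDiffAt (hU.mem_nhds hy)).isSymmSndFDerivAt
      (by rw [minSmoothness_of_isRCLikeNormedField]; exact WithTop.coe_le_coe.mpr le_top)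
  have hdiff : DifferentiableAt ℝ (fderiv ℝ F) y :=
    ((h.fderiv_of_isOpen hU (m := ∞) (by simp)).contDiffAt (hU.mem_nhds hy)).differentiableAt
      (by simp)
  have pd_pd (a b : Fin n) : pd a (pd b F) y
      = fderiv ℝ (fderiv ℝ F) y (EuclideanSpace.single a 1) (EuclideanSpace.single b 1) := by
    have : pd b F = fun x => fderiv ℝ F x (EuclideanSpace.single b 1) := rfl
    rw [pd, this, fderiv_clm_apply hdiff (differentiableAt_const _)]
    simp
  rw [pd_pd, pd_pd, hsymm]

end Partial

section MatrixField

variable {A B : Coord n → Matrix (Fin n) (Fin n) ℝ}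

/-- The entrywise partial derivative of a matrix field. -/
noncomputable def pdMatrix (i : Fin n) (A : Coord n → Matrix (Fin n) (Fin n) ℝ) (y : Coord n) :
    Matrix (Fin n) (Fin n) ℝ :=
  Matrix.of fun a b => pd i (fun x => A x a b) y

/-- Entrywise smoothness of a matrix field; matrices carry no global norm. -/
def SmoothMatrixOn (U : Set (Coord n)) (A : Coord n → Matrix (Fin n) (Fin n) ℝ) : Prop :=
  ∀ a b, SmoothOn U (fun x => A x a b)

namespace SmoothMatrixOn

theorem pdMatrix_of_isOpen (h : SmoothMatrixOn U A) (hU : IsOpen U) (i : Fin n) :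
    SmoothMatrixOn U (pdMatrix i A) :=
  fun a b => (h a b).pd_of_isOpen hU i

theorem mul (hA : SmoothMatrixOn U A) (hB : SmoothMatrixOn U B) :
    SmoothMatrixOn U (fun x => A x * B x) := by
  intro a b
  simp only [Matrix.mul_apply]
  exact SmoothOn.sum fun k => (hA a k).mul (hB k b)

theorem add (hA : SmoothMatrixOn U A) (hB : SmoothMatrixOn U B) :
    SmoothMatrixOn U (fun x => A x + B x) :=
  fun a b => (hA a b).add (hB a b)

theorem sub (hA : SmoothMatrixOn U A) (hB : SmoothMatrixOn U B) :
    SmoothMatrixOn U (fun x => A x - B x) :=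
  fun a b => (hA a b).sub (hB a b)

theorem transpose (hA : SmoothMatrixOn U A) : SmoothMatrixOn U (fun x => (A x)ᵀ) :=
  fun a b => hA b a

theorem det (hA : SmoothMatrixOn U A) : SmoothOn U (fun x => (A x).det) := by
  simp only [Matrix.det_apply]
  exact SmoothOn.sum fun σ => (contDiffOn_prod fun i _ => hA _ _).const_smul _

theorem adjugate (hA : SmoothMatrixOn U A) : SmoothMatrixOn U (fun x => (A x).adjugate) := by
  intro a b
  simp only [Matrix.adjugate_apply]
  refine SmoothMatrixOn.det fun i j => ?_
  by_cases h : i = b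
  · subst h
    simpa using contDiffOn_const
  · simpa [Matrix.updateRow_apply, h] using hA i j

theorem inv (hA : SmoothMatrixOn U A) (hdet : ∀ x ∈ U, IsUnit (A x).det) :
    SmoothMatrixOn U (fun x => (A x)⁻¹) := fun a b =>
  ((hA.det.inv fun x hx => (hdet x hx).ne_zero).mul (hA.adjugate a b)).congr fun x _ => by
    simp [Matrix.inv_def]

end SmoothMatrixOn

theorem pdMatrix_congr (hU : IsOpen U) (h : Set.EqOn A B U) (hy : y ∈ U) (i : Fin n) :
    pdMatrix i A y = pdMatrix i B y := by
  ext a b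
  exact pd_congr hU (fun x hx => by simp only [h hx]) hy i

theorem pdMatrix_mul (hA : SmoothMatrixOn U A) (hB : SmoothMatrixOn U B) (hU : IsOpen U)
    (hy : y ∈ U) (i : Fin n) :
    pdMatrix i (fun x => A x * B x) y = pdMatrix i A y * B y + A y * pdMatrix i B y := by
  have hA' a b := (hA a b).differentiableAt hU hy
  have hB' a b := (hB a b).differentiableAt hU hy
  ext a b
  simp only [pdMatrix, Matrix.mul_apply, Matrix.of_apply, Matrix.add_apply]
  rw [pd_sum _ _ fun k => (hA' a k).fun_mul (hB' k b), ← Finset.sum_add_distrib]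
  exact Finset.sum_congr rfl fun k _ => pd_mul i (hA' a k) (hB' k b)

theorem pdMatrix_add (hA : SmoothMatrixOn U A) (hB : SmoothMatrixOn U B) (hU : IsOpen U)
    (hy : y ∈ U) (i : Fin n) :
    pdMatrix i (fun x => A x + B x) y = pdMatrix i A y + pdMatrix i B y := by
  ext a b
  exact pd_add i ((hA a b).differentiableAt hU hy) ((hB a b).differentiableAt hU hy)

theorem pdMatrix_sub (hA : SmoothMatrixOn U A) (hB : SmoothMatrixOn U B) (hU : IsOpen U)
    (hy : y ∈ U) (i : Fin n) :
    pdMatrix i (fun x => A x - B x) y = pdMatrix i A y - pdMatrix i B y := by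
  ext a b
  exact pd_sub i ((hA a b).differentiableAt hU hy) ((hB a b).differentiableAt hU hy)

theorem pdMatrix_transpose (A : Coord n → Matrix (Fin n) (Fin n) ℝ) (i : Fin n) (y : Coord n) :
    pdMatrix i (fun x => (A x)ᵀ) y = (pdMatrix i A y)ᵀ := rfl

theorem pdMatrix_comm (hA : SmoothMatrixOn U A) (hU : IsOpen U) (hy : y ∈ U) (i j : Fin n) :
    pdMatrix i (pdMatrix j A) y = pdMatrix j (pdMatrix i A) y := by
  ext a b
  exact pd_comm (hA a b) hU hy i j

theorem pd_trace (hA : SmoothMatrixOn U A) (hU : IsOpen U) (hy : y ∈ U) (i : Fin n) :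
    pd i (fun x => (A x).trace) y = (pdMatrix i A y).trace :=
  pd_sum _ _ fun k => (hA k k).differentiableAt hU hy

end MatrixField

/-! ### The Levi-Civita connection and its curvature -/

/-- `G` is a smooth Riemannian metric on the open set `U` of the coordinate space. -/
structure IsMetricOn (U : Set (Coord n)) (G : CoordMetric n) : Prop where
  isOpen : IsOpen U
  smooth : SmoothMatrixOn U G
  posDef : ∀ x ∈ U, (G x).PosDef

/-- The matrix `(Γ_i)^m_k = Γ^m_{ik}` of the connection. -/
noncomputable def connMatrix (G : CoordMetric n) (i : Fin n) (y : Coord n) :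
    Matrix (Fin n) (Fin n) ℝ :=
  Matrix.of fun m k => christoffel G m i k y

/-- The curvature matrix `(R_{ij})^m_k = R_{ijk}^m`. -/
noncomputable def curvMatrix (G : CoordMetric n) (i j : Fin n) (y : Coord n) :
    Matrix (Fin n) (Fin n) ℝ :=
  pdMatrix j (connMatrix G i) y - pdMatrix i (connMatrix G j) y
    + (connMatrix G j y * connMatrix G i y - connMatrix G i y * connMatrix G j y)

/-- The derivative `∂_p R_{ij} + [Γ_p, R_{ij}]` of the curvature as an endomorphism-valued `2`-form:
the Christoffel symbols act on the endomorphism slots only. -/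
noncomputable def covCurvMatrix (G : CoordMetric n) (p i j : Fin n) (y : Coord n) :
    Matrix (Fin n) (Fin n) ℝ :=
  pdMatrix p (curvMatrix G i j) y + connMatrix G p y * curvMatrix G i j y
    - curvMatrix G i j y * connMatrix G p y

theorem riem_eq_mul_curvMatrix (G : CoordMetric n) (i j k l : Fin n) (y : Coord n) :
    riem G i j k l y = (G y * curvMatrix G i j y) l k := by
  simp only [riem, Matrix.mul_apply, curvMatrix, Matrix.add_apply, Matrix.sub_apply,
    Finset.sum_sub_distrib]
  refine Finset.sum_congr rfl fun m _ => ?_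
  congr 2
  congr 1 <;> exact Finset.sum_congr rfl fun p _ => mul_comm _ _

theorem curvMatrix_antisymm (G : CoordMetric n) (i j : Fin n) (y : Coord n) :
    curvMatrix G i j y = -curvMatrix G j i y := by
  simp only [curvMatrix]
  noncomm_ring

theorem riem_antisymm_left (G : CoordMetric n) (i j k l : Fin n) (y : Coord n) :
    riem G i j k l y = -riem G j i k l y := by
  rw [riem_eq_mul_curvMatrix, riem_eq_mul_curvMatrix, curvMatrix_antisymm, Matrix.mul_neg,
    Matrix.neg_apply]

namespace IsMetricOn

theorem mono (h : IsMetricOn U G) {V : Set (Coord n)} (hV : IsOpen V) (hVU : V ⊆ U) :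
    IsMetricOn V G :=
  ⟨hV, fun a b => (h.smooth a b).mono hVU, fun x hx => h.posDef x (hVU hx)⟩

theorem isSymm (h : IsMetricOn U G) (hy : y ∈ U) : (G y).IsSymm :=
  (conjTranspose_eq_transpose_of_trivial _).symm.trans (h.posDef y hy).isHermitian

theorem isUnit_det (h : IsMetricOn U G) (hy : y ∈ U) : IsUnit (G y).det :=
  (h.posDef y hy).det_pos.ne'.isUnit

theorem inv_mul (h : IsMetricOn U G) (hy : y ∈ U) : (G y)⁻¹ * G y = 1 :=
  Matrix.nonsing_inv_mul _ (h.isUnit_det hy)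

theorem mul_inv (h : IsMetricOn U G) (hy : y ∈ U) : G y * (G y)⁻¹ = 1 :=
  Matrix.mul_nonsing_inv _ (h.isUnit_det hy)

theorem smooth_inv (h : IsMetricOn U G) : SmoothMatrixOn U (fun x => (G x)⁻¹) :=
  h.smooth.inv fun _ hx => h.isUnit_det hx

theorem smooth_christoffel (h : IsMetricOn U G) (k i j : Fin n) :
    SmoothOn U (christoffel G k i j) := by
  have smooth_pd (i j l : Fin n) := (h.smooth j l).pd_of_isOpen h.isOpen i
  exact contDiffOn_const.mul (SmoothOn.sum fun l => (h.smooth_inv k l).mul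
    (((smooth_pd i j l).add (smooth_pd j i l)).sub (smooth_pd l i j)))

theorem smooth_connMatrix (h : IsMetricOn U G) (i : Fin n) : SmoothMatrixOn U (connMatrix G i) :=
  fun m k => h.smooth_christoffel m i k

theorem smooth_curvMatrix (h : IsMetricOn U G) (i j : Fin n) :
    SmoothMatrixOn U (curvMatrix G i j) := by
  have smooth_pd (i j : Fin n) := (h.smooth_connMatrix j).pdMatrix_of_isOpen h.isOpen i
  have smooth_mul (i j : Fin n) := (h.smooth_connMatrix i).mul (h.smooth_connMatrix j)
  exact ((smooth_pd j i).sub (smooth_pd i j)).add ((smooth_mul j i).sub (smooth_mul i j))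

theorem pd_metric_symm (h : IsMetricOn U G) (hy : y ∈ U) (i j k : Fin n) :
    pd i (fun x => G x j k) y = pd i (fun x => G x k j) y :=
  pd_congr h.isOpen (fun _ hx => (h.isSymm hx).apply k j) hy i

theorem christoffel_symm (h : IsMetricOn U G) (hy : y ∈ U) (k i j : Fin n) :
    christoffel G k i j y = christoffel G k j i y := by
  simp only [christoffel, h.pd_metric_symm hy _ i j, add_comm (pd i _ y)]

theorem mulVec_christoffel (h : IsMetricOn U G) (hy : y ∈ U) (i j l : Fin n) :
    (G y *ᵥ fun m => christoffel G m i j y) l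
      = (1 / 2) * (pd i (fun x => G x j l) y + pd j (fun x => G x i l) y
          - pd l (fun x => G x i j) y) := by
  set t : Fin n → ℝ := fun l => pd i (fun x => G x j l) y + pd j (fun x => G x i l) y
    - pd l (fun x => G x i j) y
  have : (fun m => christoffel G m i j y) = (1 / 2 : ℝ) • ((G y)⁻¹ *ᵥ t) := rfl
  rw [this, mulVec_smul, mulVec_mulVec, h.mul_inv hy, one_mulVec]
  rfl

theorem pdMatrix_metric (h : IsMetricOn U G) (hy : y ∈ U) (i : Fin n) :
    pdMatrix i G y = (connMatrix G i y)ᵀ * G y + G y * connMatrix G i y := by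
  have lowered (j k : Fin n) := h.mulVec_christoffel hy i j k
  have (j k : Fin n) : ((connMatrix G i y)ᵀ * G y) j k = (G y * connMatrix G i y) k j := by
    rw [← Matrix.transpose_apply (G y * _), transpose_mul, (h.isSymm hy).eq]
  ext j k
  rw [Matrix.add_apply, this, show (G y * connMatrix G i y) k j = _ from lowered j k,
    show (G y * connMatrix G i y) j k = _ from lowered k j, h.pd_metric_symm hy k i j,
    h.pd_metric_symm hy j i k, h.pd_metric_symm hy i k j]
  simp only [pdMatrix, Matrix.of_apply]
  ring

theorem pdMatrix_inv (h : IsMetricOn U G) (hy : y ∈ U) (i : Fin n) :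
    pdMatrix i (fun x => (G x)⁻¹) y
      = -(connMatrix G i y * (G y)⁻¹ + (G y)⁻¹ * (connMatrix G i y)ᵀ) := by
  have pd_inv_mul : pdMatrix i (fun x => (G x)⁻¹) y * G y + (G y)⁻¹ * pdMatrix i G y = 0 := by
    rw [← pdMatrix_mul h.smooth_inv h.smooth h.isOpen hy,
      pdMatrix_congr h.isOpen (B := fun _ => 1) (fun x hx => h.inv_mul hx) hy]
    ext a b
    exact pd_const _ _ _
  calc pdMatrix i (fun x => (G x)⁻¹) y
      = pdMatrix i (fun x => (G x)⁻¹) y * G y * (G y)⁻¹ := by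
        rw [Matrix.mul_assoc, h.mul_inv hy, mul_one]
    _ = -((G y)⁻¹ * (connMatrix G i y)ᵀ * (G y * (G y)⁻¹)
          + (G y)⁻¹ * G y * connMatrix G i y * (G y)⁻¹) := by
        rw [eq_neg_of_add_eq_zero_left pd_inv_mul, h.pdMatrix_metric hy]
        noncomm_ring
    _ = _ := by rw [h.mul_inv hy, h.inv_mul hy, mul_one, one_mul, add_comm]

theorem mul_curvMatrix_antisymm (h : IsMetricOn U G) (hy : y ∈ U) (i j : Fin n) :
    G y * curvMatrix G i j y = -(G y * curvMatrix G i j y)ᵀ := by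
  have pd_pd (a b : Fin n) : pdMatrix a (pdMatrix b G) y
      = (pdMatrix a (connMatrix G b) y)ᵀ * G y
        + (connMatrix G b y)ᵀ * ((connMatrix G a y)ᵀ * G y + G y * connMatrix G a y)
        + (((connMatrix G a y)ᵀ * G y + G y * connMatrix G a y) * connMatrix G b y
        + G y * pdMatrix a (connMatrix G b) y) := by
    have hb := h.smooth_connMatrix b
    rw [pdMatrix_congr h.isOpen (fun x hx => h.pdMatrix_metric hx b) hy,
      pdMatrix_add (hb.transpose.mul h.smooth) (h.smooth.mul hb) h.isOpen hy,
      pdMatrix_mul hb.transpose h.smooth h.isOpen hy, pdMatrix_mul h.smooth hb h.isOpen hy,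
      pdMatrix_transpose, h.pdMatrix_metric hy]
  have commutator := sub_eq_zero.mpr (pdMatrix_comm h.smooth h.isOpen hy i j)
  rw [pd_pd, pd_pd] at commutator
  rw [eq_neg_iff_add_eq_zero, transpose_mul, (h.isSymm hy).eq, ← neg_eq_zero, ← commutator]
  simp only [curvMatrix, transpose_add, transpose_sub, transpose_mul]
  noncomm_ring

theorem riem_antisymm_right (h : IsMetricOn U G) (hy : y ∈ U) (i j k l : Fin n) :
    riem G i j k l y = -riem G i j l k y := by
  rw [riem_eq_mul_curvMatrix, riem_eq_mul_curvMatrix]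
  exact congrFun (congrFun (h.mul_curvMatrix_antisymm hy i j) l) k

theorem riem_bianchi (h : IsMetricOn U G) (hy : y ∈ U) (i j k l : Fin n) :
    riem G i j k l y + riem G j k i l y + riem G k i j l y = 0 := by
  have pd_symm (m a b c : Fin n) : pd a (christoffel G m b c) y = pd a (christoffel G m c b) y :=
    pd_congr h.isOpen (fun x hx => h.christoffel_symm hx m b c) hy a
  simp only [riem, ← Finset.sum_add_distrib, ← mul_add]
  refine Finset.sum_eq_zero fun m _ => ?_
  simp only [Finset.sum_sub_distrib, pd_symm m _ k i, pd_symm m _ k j, pd_symm m _ j i,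
    h.christoffel_symm hy _ k i, h.christoffel_symm hy _ k j, h.christoffel_symm hy _ j i]
  ring

theorem riem_pair_symm (h : IsMetricOn U G) (hy : y ∈ U) (i j k l : Fin n) :
    riem G i j k l y = riem G k l i j y := by
  have left (i j k l : Fin n) := riem_antisymm_left G i j k l y
  have right (i j k l : Fin n) := h.riem_antisymm_right hy i j k l
  have bianchi (i j k l : Fin n) := h.riem_bianchi hy i j k l
  linarith [bianchi i k j l, bianchi k j l i, bianchi j l i k, bianchi l i k j, right i k j l,
    right k j i l, right j l k i, right l i k j, left j i k l, right i j k l, left l k j i,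
    right k l i j]

theorem pdMatrix_curvMatrix (h : IsMetricOn U G) (hy : y ∈ U) (p i j : Fin n) :
    pdMatrix p (curvMatrix G i j) y
      = pdMatrix p (pdMatrix j (connMatrix G i)) y - pdMatrix p (pdMatrix i (connMatrix G j)) y
        + ((pdMatrix p (connMatrix G j) y * connMatrix G i y
            + connMatrix G j y * pdMatrix p (connMatrix G i) y)
          - (pdMatrix p (connMatrix G i) y * connMatrix G j y
            + connMatrix G i y * pdMatrix p (connMatrix G j) y)) := by
  have hi := h.smooth_connMatrix i
  have hj := h.smooth_connMatrix j
  have hdi := hi.pdMatrix_of_isOpen h.isOpen j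
  have hdj := hj.pdMatrix_of_isOpen h.isOpen i
  rw [← pdMatrix_mul hj hi h.isOpen hy, ← pdMatrix_mul hi hj h.isOpen hy,
    ← pdMatrix_sub (hj.mul hi) (hi.mul hj) h.isOpen hy, ← pdMatrix_sub hdi hdj h.isOpen hy,
    ← pdMatrix_add (hdi.sub hdj) ((hj.mul hi).sub (hi.mul hj)) h.isOpen hy]
  rfl

theorem covCurvMatrix_bianchi (h : IsMetricOn U G) (hy : y ∈ U) (p i j : Fin n) :
    covCurvMatrix G p i j y + covCurvMatrix G i j p y + covCurvMatrix G j p i y = 0 := by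
  have comm (k a b : Fin n) := pdMatrix_comm (h.smooth_connMatrix k) h.isOpen hy a b
  simp only [covCurvMatrix, h.pdMatrix_curvMatrix hy, comm i p j, comm j p i, comm p i j,
    curvMatrix]
  noncomm_ring

theorem cov4_riem (h : IsMetricOn U G) (hy : y ∈ U) (p i j k l : Fin n) :
    cov4 G (riem G) p i j k l y = (G y * covCurvMatrix G p i j y) l k
      - ∑ m, (christoffel G m p i y * riem G m j k l y
        + christoffel G m p j y * riem G i m k l y) := by
  have pd_riem : pd p (riem G i j k l) y
      = (pdMatrix p G y * curvMatrix G i j y + G y * pdMatrix p (curvMatrix G i j) y) l k := by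
    rw [← pdMatrix_mul h.smooth (h.smooth_curvMatrix i j) h.isOpen hy]
    exact congrArg (pd p · y) (funext fun x => riem_eq_mul_curvMatrix G i j k l x)
  have third_slot : ∑ m, christoffel G m p k y * riem G i j m l y
      = (G y * curvMatrix G i j y * connMatrix G p y) l k := by
    rw [Matrix.mul_apply]
    exact Finset.sum_congr rfl fun m _ => by
      rw [riem_eq_mul_curvMatrix, mul_comm, connMatrix, Matrix.of_apply]
  have fourth_slot : ∑ m, christoffel G m p l y * riem G i j k m y
      = ((connMatrix G p y)ᵀ * (G y * curvMatrix G i j y)) l k := by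
    rw [Matrix.mul_apply]
    exact Finset.sum_congr rfl fun m _ => by
      rw [riem_eq_mul_curvMatrix, Matrix.transpose_apply, connMatrix, Matrix.of_apply]
  have expand : G y * covCurvMatrix G p i j y
      = pdMatrix p G y * curvMatrix G i j y + G y * pdMatrix p (curvMatrix G i j) y
        - G y * curvMatrix G i j y * connMatrix G p y
        - (connMatrix G p y)ᵀ * (G y * curvMatrix G i j y) := by
    rw [h.pdMatrix_metric hy, covCurvMatrix]
    noncomm_ring
  rw [cov4, expand, Matrix.sub_apply, Matrix.sub_apply, ← pd_riem, ← third_slot, ← fourth_slot]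
  simp only [Finset.sum_add_distrib]
  ring

theorem cov4_riem_bianchi (h : IsMetricOn U G) (hy : y ∈ U) (p i j k l : Fin n) :
    cov4 G (riem G) p i j k l y + cov4 G (riem G) i j p k l y + cov4 G (riem G) j p i k l y
      = 0 := by
  have matrix_bianchi : (G y * covCurvMatrix G p i j y) l k + (G y * covCurvMatrix G i j p y) l k
      + (G y * covCurvMatrix G j p i y) l k = 0 := by
    rw [← Matrix.add_apply, ← Matrix.add_apply, ← mul_add, ← mul_add,
      h.covCurvMatrix_bianchi hy, mul_zero, Matrix.zero_apply]
  have christoffel_terms (a b c : Fin n) :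
      ∑ m, christoffel G m a b y * riem G c m k l y
        = -∑ m, christoffel G m b a y * riem G m c k l y := by
    rw [← Finset.sum_neg_distrib]
    exact Finset.sum_congr rfl fun m _ => by
      rw [riem_antisymm_left, h.christoffel_symm hy m a b, mul_neg]
  simp only [h.cov4_riem hy, Finset.sum_add_distrib, christoffel_terms]
  linear_combination matrix_bianchi

end IsMetricOn

/-! ### Calculus of covariant derivatives -/

section CovariantDerivative

variable {A B : Fin n → Fin n → Coord n → ℝ} {Q R : Fin n → Fin n → Fin n → Fin n → Coord n → ℝ}

theorem cov2_add (G : CoordMetric n) (i j k : Fin n) (hA : DifferentiableAt ℝ (A j k) y)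
    (hB : DifferentiableAt ℝ (B j k) y) :
    cov2 G (fun j k x => A j k x + B j k x) i j k y = cov2 G A i j k y + cov2 G B i j k y := by
  simp only [cov2, pd_add i hA hB, mul_add, Finset.sum_add_distrib]
  ring

theorem cov2_sub (G : CoordMetric n) (i j k : Fin n) (hA : DifferentiableAt ℝ (A j k) y)
    (hB : DifferentiableAt ℝ (B j k) y) :
    cov2 G (fun j k x => A j k x - B j k x) i j k y = cov2 G A i j k y - cov2 G B i j k y := by
  simp only [cov2, pd_sub i hA hB, mul_sub, Finset.sum_add_distrib, Finset.sum_sub_distrib]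
  ring

theorem cov2_mul (G : CoordMetric n) (i j k : Fin n) {F : Coord n → ℝ}
    (hF : DifferentiableAt ℝ F y) (hA : DifferentiableAt ℝ (A j k) y) :
    cov2 G (fun j k x => F x * A j k x) i j k y = pd i F y * A j k y + F y * cov2 G A i j k y := by
  simp only [cov2, pd_mul i hF hA, mul_left_comm _ (F y), ← mul_add, ← Finset.mul_sum]
  ring

theorem cov2_mul_form (G : CoordMetric n) (i j k : Fin n) {φ ψ : Fin n → Coord n → ℝ}
    (hφ : DifferentiableAt ℝ (φ j) y) (hψ : DifferentiableAt ℝ (ψ k) y) :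
    cov2 G (fun j k x => φ j x * ψ k x) i j k y
      = cov1 G φ i j y * ψ k y + φ j y * cov1 G ψ i k y := by
  simp only [cov2, cov1, pd_mul i hφ hψ, Finset.sum_add_distrib, ← mul_assoc, ← Finset.sum_mul,
    mul_right_comm _ (φ j y)]
  ring

theorem cov2_congr (G : CoordMetric n) (hU : IsOpen U) (hy : y ∈ U)
    (h : ∀ j k, Set.EqOn (A j k) (B j k) U) (i j k : Fin n) :
    cov2 G A i j k y = cov2 G B i j k y := by
  simp only [cov2, pd_congr hU (h j k) hy, h _ _ hy]

theorem cov3_eq_zero (G : CoordMetric n) (hU : IsOpen U) (hy : y ∈ U)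
    {A : Fin n → Fin n → Fin n → Coord n → ℝ} (h : ∀ j k l, ∀ x ∈ U, A j k l x = 0)
    (i j k l : Fin n) : cov3 G A i j k l y = 0 := by
  simp [cov3, pd_congr hU (h j k l) hy, pd_const, h _ _ _ y hy]

theorem cov4_congr (G : CoordMetric n) (hU : IsOpen U) (hy : y ∈ U)
    (h : ∀ i j k l, Set.EqOn (Q i j k l) (R i j k l) U) (p i j k l : Fin n) :
    cov4 G Q p i j k l y = cov4 G R p i j k l y := by
  simp only [cov4, pd_congr hU (h i j k l) hy, h _ _ _ _ hy]

theorem cov4_neg (G : CoordMetric n) (p i j k l : Fin n) (y : Coord n) :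
    cov4 G (fun i j k l x => -Q i j k l x) p i j k l y = -cov4 G Q p i j k l y := by
  simp only [cov4, pd_neg, mul_neg, ← neg_add, Finset.sum_neg_distrib]
  ring

theorem cov4_add (G : CoordMetric n) (p i j k l : Fin n) (hQ : DifferentiableAt ℝ (Q i j k l) y)
    (hR : DifferentiableAt ℝ (R i j k l) y) :
    cov4 G (fun i j k l x => Q i j k l x + R i j k l x) p i j k l y
      = cov4 G Q p i j k l y + cov4 G R p i j k l y := by
  simp only [cov4, pd_add p hQ hR, mul_add, Finset.sum_add_distrib]
  ring

theorem cov4_sub (G : CoordMetric n) (p i j k l : Fin n) (hQ : DifferentiableAt ℝ (Q i j k l) y)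
    (hR : DifferentiableAt ℝ (R i j k l) y) :
    cov4 G (fun i j k l x => Q i j k l x - R i j k l x) p i j k l y
      = cov4 G Q p i j k l y - cov4 G R p i j k l y := by
  simp only [cov4, pd_sub p hQ hR, mul_sub, Finset.sum_add_distrib, Finset.sum_sub_distrib]
  ring

theorem cov4_swap_left (G : CoordMetric n) (Q : Fin n → Fin n → Fin n → Fin n → Coord n → ℝ)
    (p i j k l : Fin n) (y : Coord n) :
    cov4 G (fun i j k l => Q j i k l) p i j k l y = cov4 G Q p j i k l y := by
  simp only [cov4, Finset.sum_add_distrib]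
  ring

theorem cov4_swap_right (G : CoordMetric n) (Q : Fin n → Fin n → Fin n → Fin n → Coord n → ℝ)
    (p i j k l : Fin n) (y : Coord n) :
    cov4 G (fun i j k l => Q i j l k) p i j k l y = cov4 G Q p i j l k y := by
  simp only [cov4, Finset.sum_add_distrib]
  ring

theorem cov4_mul (G : CoordMetric n) (p i j k l : Fin n) (hA : DifferentiableAt ℝ (A i k) y)
    (hB : DifferentiableAt ℝ (B j l) y) :
    cov4 G (fun i j k l x => A i k x * B j l x) p i j k l y
      = cov2 G A p i k y * B j l y + A i k y * cov2 G B p j l y := by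
  simp only [cov4, cov2, pd_mul p hA hB, Finset.sum_add_distrib, ← mul_assoc, ← Finset.sum_mul,
    mul_right_comm _ (A i k y)]
  ring

theorem cov4_kulkarniNomizu (G : CoordMetric n) (p i j k l : Fin n)
    (hA : ∀ i j, DifferentiableAt ℝ (A i j) y) (hB : ∀ i j, DifferentiableAt ℝ (B i j) y) :
    cov4 G (fun i j k l x => kulkarniNomizu (A · · x) (B · · x) i j k l) p i j k l y
      = kulkarniNomizu (cov2 G A p · · y) (B · · y) i j k l
        + kulkarniNomizu (A · · y) (cov2 G B p · · y) i j k l := by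
  have hAB (i j k l) := (hA i k).fun_mul (hB j l)
  have hBA (i j k l) := (hB i k).fun_mul (hA j l)
  have expand : (fun i j k l x => kulkarniNomizu (A · · x) (B · · x) i j k l)
      = fun i j k l x => (A i k x * B j l x + B i k x * A j l x)
        - (A i l x * B j k x + B i l x * A j k x) := by
    funext i j k l x
    simp only [kulkarniNomizu]
    ring
  rw [expand, cov4_sub G p i j k l ((hAB ..).fun_add (hBA ..)) ((hAB ..).fun_add (hBA ..)),
    cov4_swap_right G fun i j k l x => A i k x * B j l x + B i k x * A j l x,
    cov4_add G p i j k l (hAB ..) (hBA ..), cov4_add G p i j l k (hAB ..) (hBA ..),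
    cov4_mul G p _ _ _ _ (hA ..) (hB ..), cov4_mul G p _ _ _ _ (hB ..) (hA ..),
    cov4_mul G p _ _ _ _ (hA ..) (hB ..), cov4_mul G p _ _ _ _ (hB ..) (hA ..)]
  simp only [kulkarniNomizu]
  ring

namespace IsMetricOn

theorem cov2_metric (h : IsMetricOn U G) (hy : y ∈ U) (i j k : Fin n) :
    cov2 G (fun a b x => G x a b) i j k y = 0 := by
  have := congrFun (congrFun (h.pdMatrix_metric hy i) j) k
  rw [Matrix.add_apply, Matrix.mul_apply, Matrix.mul_apply] at this
  simp only [pdMatrix, connMatrix, Matrix.transpose_apply, Matrix.of_apply,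
    mul_comm (G y j _)] at this
  rw [cov2, this, Finset.sum_add_distrib, sub_self]

theorem cov2_mul_metric (h : IsMetricOn U G) (hy : y ∈ U) {F : Coord n → ℝ}
    (hF : DifferentiableAt ℝ F y) (i j k : Fin n) :
    cov2 G (fun a b x => F x * G x a b) i j k y = pd i F y * G y j k := by
  rw [cov2_mul G i j k hF ((h.smooth j k).differentiableAt h.isOpen hy), h.cov2_metric hy,
    mul_zero, add_zero]

theorem pd_metricTrace (h : IsMetricOn U G) (hy : y ∈ U) (hA : ∀ j k, SmoothOn U (A j k))
    (i : Fin n) :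
    pd i (fun x => metricTrace (G x) (A · · x)) y = metricTrace (G y) (cov2 G A i · · y) := by
  let M (x : Coord n) : Matrix (Fin n) (Fin n) ℝ := Matrix.of (A · · x)
  have hM : SmoothMatrixOn U M := hA
  have cov2_eq : Matrix.of (cov2 G A i · · y)
      = pdMatrix i M y - ((connMatrix G i y)ᵀ * M y + M y * connMatrix G i y) := by
    ext k l
    simp only [cov2, pdMatrix, M, connMatrix, Matrix.sub_apply, Matrix.add_apply, Matrix.mul_apply,
      Matrix.transpose_apply, Matrix.of_apply, Finset.sum_add_distrib, mul_comm (A k _ y)]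
  have cyclic : (connMatrix G i y * (G y)⁻¹ * M y).trace
      = ((G y)⁻¹ * (M y * connMatrix G i y)).trace := by
    rw [Matrix.mul_assoc, Matrix.trace_mul_comm, Matrix.mul_assoc]
  have trace_eq : Set.EqOn (fun x => metricTrace (G x) (A · · x))
      (fun x => ((G x)⁻¹ * M x).trace) U :=
    fun x hx => metricTrace_eq_trace (h.isSymm hx) (M x)
  refine Eq.trans ?_ (metricTrace_eq_trace (h.isSymm hy) (Matrix.of (cov2 G A i · · y))).symm
  rw [pd_congr h.isOpen trace_eq hy, pd_trace (h.smooth_inv.mul hM) h.isOpen hy,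
    pdMatrix_mul h.smooth_inv hM h.isOpen hy,
    h.pdMatrix_inv hy, cov2_eq, mul_sub, mul_add, neg_mul,
    add_mul, Matrix.trace_add, Matrix.trace_neg, Matrix.trace_add, cyclic, Matrix.trace_sub,
    Matrix.trace_add, Matrix.mul_assoc]
  ring

theorem cov2_metricTrace (h : IsMetricOn U G) (hy : y ∈ U)
    (hQ : ∀ i j k l, SmoothOn U (Q i j k l)) (p j l : Fin n) :
    cov2 G (fun j l x => metricTrace (G x) fun i k => Q i j k l x) p j l y
      = metricTrace (G y) fun i k => cov4 G Q p i j k l y := by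
  have cov4_eq (i k : Fin n) : cov4 G Q p i j k l y = cov2 G (fun i k => Q i j k l) p i k y
      - ∑ m, (christoffel G m p j y * Q i m k l y + christoffel G m p l y * Q i j k m y) := by
    simp only [cov4, cov2, Finset.sum_add_distrib]
    ring
  simp only [cov4_eq, metricTrace_sub, metricTrace_sum, metricTrace_add, metricTrace_const_mul,
    ← h.pd_metricTrace hy (fun i k => hQ i j k l)]
  rfl

end IsMetricOn

end CovariantDerivative

/-! ### The Ricci, Weyl, Cotton and Bach tensors -/

/-- The Schouten tensor `A = 1/(n-2) (r - s/(2(n-1)) g)`, for which `R = A ∧ g + W` with the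
Kulkarni-Nomizu product. -/
noncomputable def schouten (G : CoordMetric n) (i j : Fin n) (y : Coord n) : ℝ :=
  1 / ((n : ℝ) - 2) * ric G i j y
    - 1 / (2 * ((n : ℝ) - 1) * ((n : ℝ) - 2)) * scal G y * G y i j

theorem ric_eq_metricTrace (G : CoordMetric n) (j l : Fin n) (y : Coord n) :
    ric G j l y = metricTrace (G y) fun i k => riem G i j k l y := rfl

theorem scal_eq_metricTrace (G : CoordMetric n) (y : Coord n) :
    scal G y = metricTrace (G y) (ric G · · y) := rfl

theorem divWeyl_eq_metricTrace (G : CoordMetric n) (i j k : Fin n) (y : Coord n) :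
    divWeyl G i j k y = metricTrace (G y) fun p l => cov4 G (weyl G) p i j k l y := rfl

theorem weylRic_eq_tensorInner (G : CoordMetric n) (i j : Fin n) (y : Coord n) :
    weylRic G i j y = tensorInner (G y) (fun k l => weyl G i k j l y) (ric G · · y) := by
  refine Finset.sum_congr rfl fun k _ => ?_
  rw [Finset.sum_comm]
  refine Finset.sum_congr rfl fun p _ => ?_
  simp only [metricTrace, Finset.mul_sum, mul_assoc]
  rfl

theorem weyl_eq_riem_sub_kulkarniNomizu (hn : 3 ≤ n) (G : CoordMetric n) (i j k l : Fin n)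
    (y : Coord n) :
    weyl G i j k l y = riem G i j k l y - kulkarniNomizu (schouten G · · y) (G y) i j k l := by
  have hn' : (3 : ℝ) ≤ n := by exact_mod_cast hn
  have hn₀ : (n : ℝ) ≠ 0 := by linarith
  have hn₁ : (n : ℝ) - 1 ≠ 0 := by linarith
  have hn₂ : (n : ℝ) - 2 ≠ 0 := by linarith
  simp only [weyl, tracelessRic, kulkarniNomizu, schouten]
  field_simp
  ring

namespace IsMetricOn

theorem smooth_metricTrace (h : IsMetricOn U G) {A : Fin n → Fin n → Coord n → ℝ}
    (hA : ∀ k l, SmoothOn U (A k l)) : SmoothOn U fun x => metricTrace (G x) (A · · x) :=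
  SmoothOn.sum fun k => SmoothOn.sum fun l => (h.smooth_inv k l).mul (hA k l)

theorem smooth_riem (h : IsMetricOn U G) (i j k l : Fin n) : SmoothOn U (riem G i j k l) :=
  ((h.smooth.mul (h.smooth_curvMatrix i j)) l k).congr fun x _ =>
    riem_eq_mul_curvMatrix G i j k l x

theorem smooth_ric (h : IsMetricOn U G) (j l : Fin n) : SmoothOn U (ric G j l) :=
  h.smooth_metricTrace fun i k => h.smooth_riem i j k l

theorem smooth_scal (h : IsMetricOn U G) : SmoothOn U (scal G) :=
  h.smooth_metricTrace h.smooth_ric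

theorem smooth_schouten (h : IsMetricOn U G) (i j : Fin n) : SmoothOn U (schouten G i j) :=
  (contDiffOn_const.mul (h.smooth_ric i j)).sub
    ((contDiffOn_const.mul h.smooth_scal).mul (h.smooth i j))

theorem smooth_kulkarniNomizu_schouten (h : IsMetricOn U G) (i j k l : Fin n) :
    SmoothOn U fun x => kulkarniNomizu (schouten G · · x) (G x) i j k l :=
  have (i j k l : Fin n) := (h.smooth_schouten i j).mul (h.smooth k l)
  (((this i k j l).add (this j l i k)).sub (this i l j k)).sub (this j k i l)

theorem smooth_weyl (h : IsMetricOn U G) (hn : 3 ≤ n) (i j k l : Fin n) :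
    SmoothOn U (weyl G i j k l) :=
  ((h.smooth_riem i j k l).sub (h.smooth_kulkarniNomizu_schouten i j k l)).congr fun x _ =>
    weyl_eq_riem_sub_kulkarniNomizu hn G i j k l x

theorem smooth_weylRic (h : IsMetricOn U G) (hn : 3 ≤ n) (i j : Fin n) :
    SmoothOn U (weylRic G i j) :=
  SmoothOn.sum fun k => SmoothOn.sum fun l => SmoothOn.sum fun p => SmoothOn.sum fun q =>
    (((h.smooth_inv k p).mul (h.smooth_inv l q)).mul (h.smooth_weyl hn i k j l)).mul
      (h.smooth_ric p q)

theorem smooth_cov2 (h : IsMetricOn U G) {A : Fin n → Fin n → Coord n → ℝ}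
    (hA : ∀ j k, SmoothOn U (A j k)) (i j k : Fin n) : SmoothOn U (cov2 G A i j k) :=
  ((hA j k).pd_of_isOpen h.isOpen i).sub (SmoothOn.sum fun m =>
    ((h.smooth_christoffel m i j).mul (hA m k)).add ((h.smooth_christoffel m i k).mul (hA j m)))

theorem smooth_cotton (h : IsMetricOn U G) (i j k : Fin n) : SmoothOn U (cotton G i j k) :=
  have smooth_pd_scal_mul (i j k : Fin n) :=
    (h.smooth_scal.pd_of_isOpen h.isOpen i).mul (h.smooth j k)
  ((h.smooth_cov2 h.smooth_ric i j k).sub (h.smooth_cov2 h.smooth_ric j i k)).sub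
    (contDiffOn_const.mul ((smooth_pd_scal_mul i j k).sub (smooth_pd_scal_mul j i k)))

theorem metricTrace_mul_metric_row (h : IsMetricOn U G) (hy : y ∈ U) (φ : Fin n → ℝ)
    (i : Fin n) : metricTrace (G y) (fun j k => φ j * G y i k) = φ i := by
  simpa only [(h.isSymm hy).apply] using metricTrace_mul_metric (h.isUnit_det hy) φ i

theorem ric_symm (h : IsMetricOn U G) (hy : y ∈ U) (j l : Fin n) : ric G j l y = ric G l j y := by
  rw [ric_eq_metricTrace, ric_eq_metricTrace, ← metricTrace_swap (h.isSymm hy)]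
  simp only [h.riem_pair_symm hy _ l _ j]

theorem metricTrace_riem_even_slots (h : IsMetricOn U G) (hy : y ∈ U) (i j : Fin n) :
    metricTrace (G y) (fun k l => riem G i k j l y) = ric G i j y := by
  have (k l : Fin n) : riem G i k j l y = riem G k i l j y := by
    rw [riem_antisymm_left, h.riem_antisymm_right hy, neg_neg]
  simp only [this, ric_eq_metricTrace]

theorem metricTrace_schouten (h : IsMetricOn U G) (hn : 3 ≤ n) (hy : y ∈ U) :
    metricTrace (G y) (schouten G · · y) = 1 / (2 * ((n : ℝ) - 1)) * scal G y := by
  have hn' : (3 : ℝ) ≤ n := by exact_mod_cast hn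
  have hn₁ : (n : ℝ) - 1 ≠ 0 := by linarith
  have hn₂ : (n : ℝ) - 2 ≠ 0 := by linarith
  simp only [schouten, metricTrace_sub, metricTrace_const_mul, metricTrace_const_mul _ _ (G y),
    metricTrace_metric (h.isSymm hy) (h.isUnit_det hy), Fintype.card_fin, ← scal_eq_metricTrace]
  field_simp
  ring

theorem metricTrace_weyl (h : IsMetricOn U G) (hn : 3 ≤ n) (hy : y ∈ U) (i j : Fin n) :
    metricTrace (G y) (fun k l => weyl G i k j l y) = 0 := by
  have hn' : (3 : ℝ) ≤ n := by exact_mod_cast hn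
  have hn₁ : (n : ℝ) - 1 ≠ 0 := by linarith
  have hn₂ : (n : ℝ) - 2 ≠ 0 := by linarith
  simp only [weyl_eq_riem_sub_kulkarniNomizu hn, metricTrace_sub]
  rw [h.metricTrace_riem_even_slots hy,
    metricTrace_kulkarniNomizu (h.isSymm hy) (h.isUnit_det hy) (schouten G · · y),
    h.metricTrace_schouten hn hy, Fintype.card_fin, schouten]
  field_simp
  ring

theorem cov4_riem_symm (h : IsMetricOn U G) (hy : y ∈ U) (p i j k l : Fin n) :
    cov4 G (riem G) p i j k l y = cov4 G (riem G) p j i l k y := by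
  rw [cov4_congr G h.isOpen hy (R := fun i j k l => riem G j i l k),
    cov4_swap_left G fun i j k l => riem G i j l k, cov4_swap_right]
  intro i j k l x hx
  rw [riem_antisymm_left, h.riem_antisymm_right hx, neg_neg]

theorem cov4_riem_antisymm_right (h : IsMetricOn U G) (hy : y ∈ U) (p i j k l : Fin n) :
    cov4 G (riem G) p i j k l y = -cov4 G (riem G) p i j l k y := by
  rw [cov4_congr G h.isOpen hy fun i j k l x hx => h.riem_antisymm_right hx i j k l,
    cov4_neg G (Q := fun i j k l => riem G i j l k), cov4_swap_right]

theorem cov2_ric (h : IsMetricOn U G) (hy : y ∈ U) (p j l : Fin n) :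
    cov2 G (ric G) p j l y = metricTrace (G y) fun i k => cov4 G (riem G) p i j k l y :=
  h.cov2_metricTrace hy h.smooth_riem p j l

theorem pd_scal (h : IsMetricOn U G) (hy : y ∈ U) (i : Fin n) :
    pd i (scal G) y = metricTrace (G y) (cov2 G (ric G) i · · y) :=
  h.pd_metricTrace hy h.smooth_ric i

theorem div_riem (h : IsMetricOn U G) (hy : y ∈ U) (i j k : Fin n) :
    metricTrace (G y) (fun p l => cov4 G (riem G) p i j k l y)
      = cov2 G (ric G) j i k y - cov2 G (ric G) i j k y := by
  have bianchi (p l : Fin n) : cov4 G (riem G) p i j k l y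
      = cov4 G (riem G) j p i l k y - cov4 G (riem G) i p j l k y := by
    have := h.cov4_riem_bianchi hy p i j k l
    rw [h.cov4_riem_symm hy i j p, h.cov4_riem_antisymm_right hy j p i k l] at this
    linarith
  simp only [bianchi, metricTrace_sub, ← h.cov2_ric hy]

theorem div_ric (h : IsMetricOn U G) (hy : y ∈ U) (j : Fin n) :
    metricTrace (G y) (fun p l => cov2 G (ric G) p j l y) = pd j (scal G) y / 2 := by
  have := metricTrace_comm (G y) fun p l i k => cov4 G (riem G) p i j k l y
  simp only [← h.cov2_ric hy, h.div_riem hy, metricTrace_sub, ← h.pd_scal hy] at this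
  linarith

theorem metricTrace_cotton (h : IsMetricOn U G) (hn : n ≠ 1) (hy : y ∈ U) (i : Fin n) :
    metricTrace (G y) (cotton G i · · y) = 0 := by
  have hn₁ : (n : ℝ) - 1 ≠ 0 := sub_ne_zero.mpr (by exact_mod_cast hn)
  simp only [cotton, metricTrace_sub, metricTrace_const_mul, ← h.pd_scal hy, h.div_ric hy,
    h.metricTrace_mul_metric_row hy, metricTrace_const_mul _ _ (G y),
    metricTrace_metric (h.isSymm hy) (h.isUnit_det hy), Fintype.card_fin]
  field_simp
  ring

theorem cov2_schouten (h : IsMetricOn U G) (hy : y ∈ U) (i j k : Fin n) :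
    cov2 G (schouten G) i j k y = 1 / ((n : ℝ) - 2) * cov2 G (ric G) i j k y
      - 1 / (2 * ((n : ℝ) - 1) * ((n : ℝ) - 2)) * pd i (scal G) y * G y j k := by
  have hric := (h.smooth_ric j k).differentiableAt h.isOpen hy
  have hscal := h.smooth_scal.differentiableAt h.isOpen hy
  have hG := (h.smooth j k).differentiableAt h.isOpen hy
  unfold schouten
  rw [cov2_sub G i j k (hric.const_mul _) ((hscal.const_mul _).mul hG),
    cov2_mul G i j k (differentiableAt_const _) hric, pd_const,
    h.cov2_mul_metric hy (hscal.const_mul _), pd_const_mul i _ hscal, zero_mul, zero_add]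

theorem div_schouten (h : IsMetricOn U G) (hn : 3 ≤ n) (hy : y ∈ U) (j : Fin n) :
    metricTrace (G y) (fun p l => cov2 G (schouten G) p j l y)
      = 1 / (2 * ((n : ℝ) - 1)) * pd j (scal G) y := by
  have hn' : (3 : ℝ) ≤ n := by exact_mod_cast hn
  have hn₁ : (n : ℝ) - 1 ≠ 0 := by linarith
  have hn₂ : (n : ℝ) - 2 ≠ 0 := by linarith
  simp only [h.cov2_schouten hy, metricTrace_sub, metricTrace_const_mul, h.div_ric hy, mul_assoc,
    h.metricTrace_mul_metric_row hy]
  field_simp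
  ring

theorem cov4_weyl (h : IsMetricOn U G) (hn : 3 ≤ n) (hy : y ∈ U) (p i j k l : Fin n) :
    cov4 G (weyl G) p i j k l y = cov4 G (riem G) p i j k l y
      - kulkarniNomizu (cov2 G (schouten G) p · · y) (G y) i j k l := by
  have hA i j := (h.smooth_schouten i j).differentiableAt h.isOpen hy
  have hG i j := (h.smooth i j).differentiableAt h.isOpen hy
  rw [cov4_congr G h.isOpen hy fun i j k l x _ => weyl_eq_riem_sub_kulkarniNomizu hn G i j k l x,
    cov4_sub G p i j k l ((h.smooth_riem i j k l).differentiableAt h.isOpen hy)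
      ((h.smooth_kulkarniNomizu_schouten i j k l).differentiableAt h.isOpen hy),
    cov4_kulkarniNomizu G p i j k l hA hG]
  simp only [h.cov2_metric hy]
  simp only [kulkarniNomizu, mul_zero, add_zero, sub_zero]

theorem divWeyl_eq_mul_cotton (h : IsMetricOn U G) (hn : 3 ≤ n) (hy : y ∈ U) (i j k : Fin n) :
    divWeyl G i j k y = -(((n : ℝ) - 3) / ((n : ℝ) - 2)) * cotton G i j k y := by
  have hn' : (3 : ℝ) ≤ n := by exact_mod_cast hn
  have hn₁ : (n : ℝ) - 1 ≠ 0 := by linarith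
  have hn₂ : (n : ℝ) - 2 ≠ 0 := by linarith
  have trace_kulkarniNomizu (A : Fin n → Fin n → Fin n → ℝ) :
      metricTrace (G y) (fun p l => kulkarniNomizu (A p) (G y) i j k l)
        = A j i k + G y i k * metricTrace (G y) (fun p l => A p j l)
          - G y j k * metricTrace (G y) (fun p l => A p i l) - A i j k := by
    simp only [kulkarniNomizu, metricTrace_add, metricTrace_sub,
      h.metricTrace_mul_metric_row hy (A · _ _),
      mul_comm (A _ _ _) (G y _ k), metricTrace_const_mul]
  simp only [divWeyl_eq_metricTrace, h.cov4_weyl hn hy, metricTrace_sub, h.div_riem hy]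
  rw [trace_kulkarniNomizu fun p a b => cov2 G (schouten G) p a b y, h.div_schouten hn hy,
    h.div_schouten hn hy, h.cov2_schouten hy, h.cov2_schouten hy, cotton]
  field_simp
  ring

theorem bach_eq_of_cotton_eq_zero (h : IsMetricOn U G) (hn : 3 ≤ n)
    (hC : ∀ i j k, ∀ x ∈ U, cotton G i j k x = 0) (hy : y ∈ U) (i j : Fin n) :
    bach G i j y = 1 / ((n : ℝ) - 2) * weylRic G i j y := by
  have hW (i j k : Fin n) (x) (hx : x ∈ U) : divWeyl G i j k x = 0 := by
    rw [h.divWeyl_eq_mul_cotton hn hx, hC i j k x hx, mul_zero]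
  have divCotton_eq : divCotton G i j y = 0 := by
    simp only [divCotton, cov3_eq_zero G h.isOpen hy hC, mul_zero, Finset.sum_const_zero]
  have divDivWeyl_eq : divDivWeyl G i j y = 0 := by
    simp only [divDivWeyl, cov3_eq_zero G h.isOpen hy hW, mul_zero, Finset.sum_const_zero]
  rw [bach, divCotton_eq, divDivWeyl_eq, mul_zero, mul_zero, ite_self, zero_add]

end IsMetricOn

/-! ### Static metrics and the tensor `T` -/

theorem hess_eq_zero_of_pd_eq_zero (G : CoordMetric n) (hU : IsOpen U) (hy : y ∈ U)
    (hu : ∀ i, ∀ x ∈ U, pd i u x = 0) (i j : Fin n) : hess G u i j y = 0 := by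
  simp [hess, cov1, pd_congr hU (hu j) hy, pd_const, hu _ y hy]

theorem gradTracelessRic_eq_coinner (G : CoordMetric n) (u : Coord n → ℝ) (i : Fin n)
    (y : Coord n) :
    gradTracelessRic G u i y = coinner (G y) (pd · u y) (tracelessRic G · i y) :=
  Finset.sum_congr rfl fun _ _ => Finset.sum_congr rfl fun _ _ => mul_assoc _ _ _

theorem schouten_eq_tracelessRic (hn : 3 ≤ n) (G : CoordMetric n) (i j : Fin n) (y : Coord n) :
    schouten G i j y = 1 / ((n : ℝ) - 2) * tracelessRic G i j y
      + scal G y / (2 * n * ((n : ℝ) - 1)) * G y i j := by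
  have hn' : (3 : ℝ) ≤ n := by exact_mod_cast hn
  have hn₀ : (n : ℝ) ≠ 0 := by linarith
  have hn₁ : (n : ℝ) - 1 ≠ 0 := by linarith
  have hn₂ : (n : ℝ) - 2 ≠ 0 := by linarith
  rw [schouten, tracelessRic]
  field_simp
  ring

namespace IsMetricOn

theorem cov2_cov1_sub_cov2_cov1 (h : IsMetricOn U G) {φ : Fin n → Coord n → ℝ}
    (hφ : ∀ k, SmoothOn U (φ k)) (hy : y ∈ U) (i j k : Fin n) :
    cov2 G (cov1 G φ) i j k y - cov2 G (cov1 G φ) j i k y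
      = ((φ · y) ᵥ* curvMatrix G i j y) k := by
  have pd_cov1 (i j : Fin n) : pd i (cov1 G φ j k) y = pd i (pd j (φ k)) y
      - ((φ · y) ᵥ* pdMatrix i (connMatrix G j) y) k
      - ((fun m => pd i (φ m) y) ᵥ* connMatrix G j y) k := by
    have dΓ (m : Fin n) := (h.smooth_christoffel m j k).differentiableAt h.isOpen hy
    have dφ (m : Fin n) := (hφ m).differentiableAt h.isOpen hy
    have dpd := ((hφ k).pd_of_isOpen h.isOpen j).differentiableAt h.isOpen hy
    unfold cov1
    rw [pd_sub i dpd (DifferentiableAt.fun_sum fun m _ => (dΓ m).fun_mul (dφ m)),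
      pd_sum _ _ fun m => (dΓ m).fun_mul (dφ m)]
    simp only [pd_mul i (dΓ _) (dφ _), Finset.sum_add_distrib, sub_sub]
    simp only [vecMul, dotProduct, pdMatrix, connMatrix, Matrix.of_apply, mul_comm]
  have second_slot (i j : Fin n) : ∑ m, christoffel G m i k y * cov1 G φ j m y
      = ((fun m => pd j (φ m) y) ᵥ* connMatrix G i y) k
        - ((φ · y) ᵥ* (connMatrix G j y * connMatrix G i y)) k := by
    rw [← vecMul_vecMul]
    simp only [cov1, mul_sub, Finset.sum_sub_distrib, vecMul, dotProduct, connMatrix,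
      Matrix.of_apply, mul_comm]
  simp only [cov2, Finset.sum_add_distrib, pd_cov1, second_slot, h.christoffel_symm hy _ j i,
    pd_comm (hφ k) h.isOpen hy j i, curvMatrix, vecMul_add, vecMul_sub, Pi.add_apply, Pi.sub_apply]
  ring

theorem coinner_riem (h : IsMetricOn U G) (hu : SmoothOn U u) (hy : y ∈ U) (i j k : Fin n) :
    coinner (G y) (pd · u y) (riem G i j k · y)
      = cov2 G (hess G u) i j k y - cov2 G (hess G u) j i k y := by
  have : (riem G i j k · y) = G y *ᵥ (curvMatrix G i j y).col k :=
    funext fun l => riem_eq_mul_curvMatrix G i j k l y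
  rw [this, coinner_mulVec (h.isUnit_det hy)]
  exact (h.cov2_cov1_sub_cov2_cov1 (fun k => hu.pd_of_isOpen h.isOpen k) hy i j k).symm

theorem coinner_metric_right (h : IsMetricOn U G) (hy : y ∈ U) (φ : Fin n → ℝ) (i : Fin n) :
    coinner (G y) φ (G y i) = φ i :=
  h.metricTrace_mul_metric_row hy φ i

theorem tracelessRic_symm (h : IsMetricOn U G) (hy : y ∈ U) (i j : Fin n) :
    tracelessRic G i j y = tracelessRic G j i y := by
  rw [tracelessRic, tracelessRic, h.ric_symm hy, (h.isSymm hy).apply]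

theorem coinner_tracelessRic (h : IsMetricOn U G) (hy : y ∈ U) (u : Coord n → ℝ) (i : Fin n) :
    coinner (G y) (pd · u y) (tracelessRic G i · y) = gradTracelessRic G u i y := by
  simp only [gradTracelessRic_eq_coinner, h.tracelessRic_symm hy i]

theorem coinner_schouten (h : IsMetricOn U G) (hn : 3 ≤ n) (hy : y ∈ U) (u : Coord n → ℝ)
    (i : Fin n) : coinner (G y) (pd · u y) (schouten G i · y)
      = 1 / ((n : ℝ) - 2) * gradTracelessRic G u i y
        + scal G y / (2 * n * ((n : ℝ) - 1)) * pd i u y := by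
  simp only [schouten_eq_tracelessRic hn, coinner_add, coinner_const_mul,
    h.coinner_tracelessRic hy, h.coinner_metric_right hy]

theorem weyl_antisymm_right (h : IsMetricOn U G) (hn : 3 ≤ n) (hy : y ∈ U) (i j k l : Fin n) :
    weyl G i j k l y = -weyl G i j l k y := by
  simp only [weyl_eq_riem_sub_kulkarniNomizu hn, h.riem_antisymm_right hy i j k, kulkarniNomizu]
  ring

end IsMetricOn

/-- `(G, u)` solves the vacuum static equation on the open set `U`. -/
structure IsStaticOn (U : Set (Coord n)) (G : CoordMetric n) (u : Coord n → ℝ) : Prop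
    extends IsMetricOn U G where
  smooth_fun : SmoothOn U u
  static : ∀ x ∈ U, ∀ i j, hess G u i j x
    = (ric G i j x - scal G x / ((n : ℝ) - 1) * G x i j) * u x

namespace IsStaticOn

theorem mono (h : IsStaticOn U G u) {V : Set (Coord n)} (hV : IsOpen V) (hVU : V ⊆ U) :
    IsStaticOn V G u :=
  ⟨h.toIsMetricOn.mono hV hVU, h.smooth_fun.mono hVU, fun x hx => h.static x (hVU hx)⟩

theorem cov2_hess (h : IsStaticOn U G u) (hy : y ∈ U) (i j k : Fin n) :
    cov2 G (hess G u) i j k y = pd i u y * ric G j k y + u y * cov2 G (ric G) i j k y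
      - 1 / ((n : ℝ) - 1) * (pd i (scal G) y * u y + scal G y * pd i u y) * G y j k := by
  have dr := (h.smooth_ric j k).differentiableAt h.isOpen hy
  have ds := h.smooth_scal.differentiableAt h.isOpen hy
  have dG := (h.smooth j k).differentiableAt h.isOpen hy
  have du := h.smooth_fun.differentiableAt h.isOpen hy
  have dus := (ds.fun_mul du).const_mul (1 / ((n : ℝ) - 1))
  have hess_eq (j k : Fin n) : Set.EqOn (hess G u j k)
      (fun x => u x * ric G j k x - 1 / ((n : ℝ) - 1) * (scal G x * u x) * G x j k) U := by
    intro x hx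
    rw [h.static x hx]
    ring
  rw [cov2_congr G h.isOpen hy hess_eq, cov2_sub G i j k (du.fun_mul dr) (dus.fun_mul dG),
    cov2_mul G i j k du dr, h.cov2_mul_metric hy dus, pd_const_mul i _ (ds.fun_mul du),
    pd_mul i ds du]

theorem coinner_riem_eq (h : IsStaticOn U G u) (hy : y ∈ U) (i j k : Fin n) :
    coinner (G y) (pd · u y) (riem G i j k · y)
      = pd i u y * ric G j k y - pd j u y * ric G i k y
        + u y * (cov2 G (ric G) i j k y - cov2 G (ric G) j i k y)
        - 1 / ((n : ℝ) - 1) * ((pd i (scal G) y * u y + scal G y * pd i u y) * G y j k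
          - (pd j (scal G) y * u y + scal G y * pd j u y) * G y i k) := by
  rw [h.coinner_riem h.smooth_fun hy, h.cov2_hess hy, h.cov2_hess hy]
  ring

theorem mul_pd_scal (h : IsStaticOn U G u) (hn : n ≠ 1) (hy : y ∈ U) (i : Fin n) :
    u y * pd i (scal G) y = 0 := by
  have hn₁ : (n : ℝ) - 1 ≠ 0 := sub_ne_zero.mpr (by exact_mod_cast hn)
  have trace_riem (l : Fin n) : metricTrace (G y) (fun j k => riem G i j k l y) = -ric G i l y := by
    rw [ric_eq_metricTrace, ← metricTrace_neg]
    simp only [← riem_antisymm_left]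
  have trace_eq : metricTrace (G y) (fun j k => coinner (G y) (pd · u y) (riem G i j k · y))
      = -coinner (G y) (pd · u y) (ric G i · y) := by
    simp only [coinner]
    rw [metricTrace_comm]
    simp only [metricTrace_const_mul, trace_riem, mul_neg, metricTrace_neg]
  simp only [h.coinner_riem_eq hy, metricTrace_sub, metricTrace_add, metricTrace_const_mul,
    ← scal_eq_metricTrace, ← h.pd_scal hy, h.div_ric hy, metricTrace_const_mul _ _ (G y),
    metricTrace_metric (h.isSymm hy) (h.isUnit_det hy), Fintype.card_fin,
    h.metricTrace_mul_metric_row hy fun j => pd j (scal G) y * u y + scal G y * pd j u y]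
    at trace_eq
  rw [show metricTrace (G y) (fun j k => pd j u y * ric G i k y)
    = coinner (G y) (pd · u y) (ric G i · y) from rfl] at trace_eq
  field_simp at trace_eq
  linear_combination -trace_eq

theorem coinner_weyl (h : IsStaticOn U G u) (hn : 3 ≤ n) (hy : y ∈ U) (i j k : Fin n) :
    coinner (G y) (pd · u y) (weyl G i j k · y)
      = u y * cotton G i j k y + ((n : ℝ) - 1) * tensorT G u i j k y := by
  have hn' : (3 : ℝ) ≤ n := by exact_mod_cast hn
  have hn₀ : (n : ℝ) ≠ 0 := by linarith
  have hn₁ : (n : ℝ) - 1 ≠ 0 := by linarith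
  have hn₂ : (n : ℝ) - 2 ≠ 0 := by linarith
  have ds (i : Fin n) : u y * pd i (scal G) y = 0 := h.mul_pd_scal (by lia) hy i
  have coinner_kulkarniNomizu : coinner (G y) (pd · u y)
      (fun l => kulkarniNomizu (schouten G · · y) (G y) i j k l)
      = schouten G i k y * pd j u y + G y i k * coinner (G y) (pd · u y) (schouten G j · y)
        - G y j k * coinner (G y) (pd · u y) (schouten G i · y)
        - schouten G j k y * pd i u y := by
    simp only [kulkarniNomizu, coinner_add, coinner_sub, mul_comm (schouten G _ _ _) (G y _ k),
      coinner_const_mul, h.coinner_metric_right hy]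
  simp only [weyl_eq_riem_sub_kulkarniNomizu hn, coinner_sub]
  rw [coinner_kulkarniNomizu, h.coinner_riem_eq hy, h.coinner_schouten hn hy,
    h.coinner_schouten hn hy,
    schouten_eq_tracelessRic hn, schouten_eq_tracelessRic hn, cotton, tensorT]
  simp only [tracelessRic]
  field_simp
  linear_combination -(n * ((n : ℝ) - 2) * G y j k) * ds i + n * ((n : ℝ) - 2) * G y i k * ds j

end IsStaticOn

/-! ### Vanishing of the Cotton and Bach tensors -/

theorem IsMetricOn.cotton_eq_of_ric_eq (h : IsMetricOn U G) (hu : SmoothOn U u)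
    {a b : Coord n → ℝ} (ha : SmoothOn U a) (hb : SmoothOn U b)
    (hric : ∀ x ∈ U, ∀ j k, ric G j k x = a x * (pd j u x * pd k u x) + b x * G x j k)
    (hy : y ∈ U) {c κ : ℝ}
    (hhess : ∀ i j, hess G u i j y = c * (pd i u y * pd j u y) + κ * G y i j) (i j k : Fin n) :
    cotton G i j k y = pd k u y * (pd i a y * pd j u y - pd j a y * pd i u y)
      + ((pd i b y - a y * κ * pd i u y - 1 / (2 * ((n : ℝ) - 1)) * pd i (scal G) y) * G y j k
        - (pd j b y - a y * κ * pd j u y - 1 / (2 * ((n : ℝ) - 1)) * pd j (scal G) y)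
          * G y i k) := by
  have da := ha.differentiableAt h.isOpen hy
  have db := hb.differentiableAt h.isOpen hy
  have dG (j k : Fin n) := (h.smooth j k).differentiableAt h.isOpen hy
  have dp (j : Fin n) := (hu.pd_of_isOpen h.isOpen j).differentiableAt h.isOpen hy
  have cov2_ric (i j k : Fin n) : cov2 G (ric G) i j k y = pd i a y * (pd j u y * pd k u y)
      + a y * (hess G u i j y * pd k u y + pd j u y * hess G u i k y) + pd i b y * G y j k := by
    rw [cov2_congr G h.isOpen hy fun j k x hx => hric x hx j k,
      cov2_add G i j k (da.fun_mul ((dp j).fun_mul (dp k))) (db.fun_mul (dG j k)),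
      cov2_mul G i j k da ((dp j).fun_mul (dp k)), cov2_mul_form G i j k (dp j) (dp k),
      h.cov2_mul_metric hy db]
    rfl
  rw [cotton, cov2_ric, cov2_ric]
  simp only [hhess, (h.isSymm hy).apply i j]
  ring

namespace IsMetricOn

theorem tracelessRic_eq_of_tensorT_eq_zero (h : IsMetricOn U G) (hn : 3 ≤ n) (hy : y ∈ U)
    (hp : (pd · u y) ≠ 0) (hT : ∀ i j k, tensorT G u i j k y = 0) (j k : Fin n) :
    tracelessRic G j k y
      = ((1 + 1 / ((n : ℝ) - 1)) * coinner (G y) (pd · u y) (gradTracelessRic G u · y)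
          / coinner (G y) (pd · u y) (pd · u y) ^ 2) * (pd j u y * pd k u y)
        + -(1 / ((n : ℝ) - 1) * coinner (G y) (pd · u y) (gradTracelessRic G u · y)
          / coinner (G y) (pd · u y) (pd · u y)) * G y j k := by
  have hn' : (3 : ℝ) ≤ n := by exact_mod_cast hn
  have hn₁ : (n : ℝ) - 1 ≠ 0 := by linarith
  have hn₂ : (n : ℝ) - 2 ≠ 0 := by linarith
  have hc : 1 / ((n : ℝ) - 1) ≠ 1 := by
    rw [Ne, div_eq_one_iff_eq hn₁]
    intro hn_eq
    linarith
  refine eq_of_wedge_add_wedge_eq_zero (h.isSymm hy) (h.isUnit_det hy) hc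
    (coinner_self_pos (h.posDef y hy) hp).ne' (h.tracelessRic_symm hy)
    (fun j => (gradTracelessRic_eq_coinner G u j y).symm) (fun i j k => ?_) j k
  have wedge := hT i j k
  rw [tensorT] at wedge
  field_simp at wedge ⊢
  linear_combination wedge

theorem exists_ric_eq_of_tensorT_eq_zero (h : IsMetricOn U G) (hn : 3 ≤ n) (hu : SmoothOn U u)
    (hp : ∀ x ∈ U, (pd · u x) ≠ 0) (hT : ∀ x ∈ U, ∀ i j k, tensorT G u i j k x = 0) :
    ∃ a b : Coord n → ℝ, SmoothOn U a ∧ SmoothOn U b ∧ ∀ x ∈ U, ∀ j k,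
      ric G j k x = a x * (pd j u x * pd k u x) + b x * G x j k := by
  set N : Coord n → ℝ := fun x => coinner (G x) (pd · u x) (pd · u x)
  set Z : Coord n → ℝ := fun x => coinner (G x) (pd · u x) (gradTracelessRic G u · x)
  have smooth_pd (i : Fin n) := hu.pd_of_isOpen h.isOpen i
  have smooth_coinner {φ : Fin n → Coord n → ℝ} (hφ : ∀ i, SmoothOn U (φ i)) :
      SmoothOn U fun x => coinner (G x) (pd · u x) (φ · x) :=
    h.smooth_metricTrace fun i j => (smooth_pd i).mul (hφ j)
  have smooth_z (i j : Fin n) : SmoothOn U (tracelessRic G i j) :=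
    (h.smooth_ric i j).sub ((h.smooth_scal.div_const _).mul (h.smooth i j))
  have smooth_grad (i : Fin n) : SmoothOn U (gradTracelessRic G u i) := by
    rw [funext (gradTracelessRic_eq_coinner G u i)]
    exact smooth_coinner fun j => smooth_z j i
  have smooth_N : SmoothOn U N := smooth_coinner smooth_pd
  have smooth_Z : SmoothOn U Z := smooth_coinner smooth_grad
  have hN : ∀ x ∈ U, N x ≠ 0 := fun x hx => (coinner_self_pos (h.posDef x hx) (hp x hx)).ne'
  refine ⟨fun x => (1 + 1 / ((n : ℝ) - 1)) * Z x / N x ^ 2,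
    fun x => -(1 / ((n : ℝ) - 1) * Z x / N x) + scal G x / n,
    (contDiffOn_const.mul smooth_Z).div (smooth_N.pow 2) fun x hx => pow_ne_zero 2 (hN x hx),
    ((contDiffOn_const.mul smooth_Z).div smooth_N hN).neg.add (h.smooth_scal.div_const _),
    fun x hx j k => ?_⟩
  have := h.tracelessRic_eq_of_tensorT_eq_zero hn hx (hp x hx) (hT x hx) j k
  rw [tracelessRic] at this
  linear_combination this

end IsMetricOn

namespace IsStaticOn

theorem coinner_cotton (h : IsStaticOn U G u) (hn : 3 ≤ n) (hy : y ∈ U) (hu : u y ≠ 0)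
    (hT : ∀ i j k, tensorT G u i j k y = 0) (i j : Fin n) :
    coinner (G y) (pd · u y) (cotton G i j · y) = 0 := by
  have := coinner_coinner_eq_zero_of_antisymm (G y) (pd · u y)
    fun k l => h.weyl_antisymm_right hn hy i j k l
  simp only [h.coinner_weyl hn hy, hT, mul_zero, add_zero, coinner_const_mul] at this
  exact (mul_eq_zero.mp this).resolve_left hu

theorem cotton_eq_zero_of_forall_pd_ne_zero (h : IsStaticOn U G u) (hn : 3 ≤ n)
    (hp : ∀ x ∈ U, (pd · u x) ≠ 0) (hT : ∀ x ∈ U, ∀ i j k, tensorT G u i j k x = 0)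
    (hy : y ∈ U) (hu : u y ≠ 0) (i j k : Fin n) : cotton G i j k y = 0 := by
  have hn' : (3 : ℝ) ≤ n := by exact_mod_cast hn
  obtain ⟨a, b, ha, hb, hric⟩ := h.exists_ric_eq_of_tensorT_eq_zero hn h.smooth_fun hp hT
  have hhess (i j : Fin n) : hess G u i j y = a y * u y * (pd i u y * pd j u y)
      + (b y - scal G y / ((n : ℝ) - 1)) * u y * G y i j := by
    rw [h.static y hy, hric y hy]
    ring
  refine eq_zero_of_wedge_mul_add_wedge_metric (h.isSymm hy) (h.isUnit_det hy) ?_ ?_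
    (coinner_self_pos (h.posDef y hy) (hp y hy)).ne'
    (h.cotton_eq_of_ric_eq h.smooth_fun ha hb hric hy hhess)
    (h.metricTrace_cotton (by lia) hy) (h.coinner_cotton hn hy hu (hT y hy)) i j k
  all_goals rw [Fintype.card_fin]; linarith

theorem weylRic_eq_zero_of_ric_eq (h : IsStaticOn U G u) (hn : 3 ≤ n) (hy : y ∈ U)
    (hT : ∀ i j k, tensorT G u i j k y = 0) (hC : ∀ i j k, cotton G i j k y = 0) {a b : ℝ}
    (hric : ∀ j k, ric G j k y = a * (pd j u y * pd k u y) + b * G y j k) (i j : Fin n) :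
    weylRic G i j y = 0 := by
  have coinner_weyl (i j k : Fin n) : coinner (G y) (pd · u y) (weyl G i j k · y) = 0 := by
    rw [h.coinner_weyl hn hy, hC, hT, mul_zero, mul_zero, add_zero]
  simp only [weylRic_eq_tensorInner, hric, tensorInner_add]
  rw [tensorInner_const_mul, tensorInner_mul_self (h.isSymm hy),
    tensorInner_const_mul _ _ b (G y), tensorInner_metric (h.isSymm hy) (h.isUnit_det hy),
    h.metricTrace_weyl hn hy]
  simp only [coinner_weyl, coinner_zero, mul_zero, add_zero]

theorem cotton_and_weylRic_eq_zero_of_pd_ne_zero (h : IsStaticOn U G u) (hn : 3 ≤ n)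
    (hT : ∀ x ∈ U, ∀ i j k, tensorT G u i j k x = 0) (hy : y ∈ U) (hu : u y ≠ 0)
    (hp : (pd · u y) ≠ 0) :
    (∀ i j k, cotton G i j k y = 0) ∧ ∀ i j, weylRic G i j y = 0 := by
  have hdu : ContinuousOn (fun x i => pd i u x) U :=
    continuousOn_pi.mpr fun i => (h.smooth_fun.pd_of_isOpen h.isOpen i).continuousOn
  set V := U ∩ (fun x i => pd i u x) ⁻¹' {0}ᶜ
  have hV : IsStaticOn V G u :=
    h.mono (hdu.isOpen_inter_preimage h.isOpen isOpen_compl_singleton) Set.inter_subset_left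
  have hyV : y ∈ V := ⟨hy, hp⟩
  have hpV : ∀ x ∈ V, (pd · u x) ≠ 0 := fun x hx => hx.2
  have hTV : ∀ x ∈ V, ∀ i j k, tensorT G u i j k x = 0 := fun x hx => hT x hx.1
  have hC := hV.cotton_eq_zero_of_forall_pd_ne_zero hn hpV hTV hyV hu
  obtain ⟨a, b, -, -, hric⟩ := hV.exists_ric_eq_of_tensorT_eq_zero hn hV.smooth_fun hpV hTV
  exact ⟨hC, h.weylRic_eq_zero_of_ric_eq hn hy (hT y hy) hC (hric y hyV)⟩

theorem ric_eq_zero_of_pd_eq_zero (h : IsStaticOn U G u) (hn : n ≠ 1)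
    (hp : ∀ x ∈ U, ∀ i, pd i u x = 0) (hy : y ∈ U) (hu : u y ≠ 0) (i j : Fin n) :
    ric G i j y = 0 := by
  have hn₁ : (n : ℝ) - 1 ≠ 0 := sub_ne_zero.mpr (by exact_mod_cast hn)
  have hric (i j : Fin n) : ric G i j y = scal G y / ((n : ℝ) - 1) * G y i j := by
    have := h.static y hy i j
    rw [hess_eq_zero_of_pd_eq_zero G h.isOpen hy fun i x hx => hp x hx i] at this
    exact sub_eq_zero.mp ((mul_eq_zero.mp this.symm).resolve_right hu)
  have trace_ric : scal G y = scal G y / ((n : ℝ) - 1) * n := by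
    conv_lhs => rw [scal_eq_metricTrace, funext₂ hric, metricTrace_const_mul _ _ (G y),
      metricTrace_metric (h.isSymm hy) (h.isUnit_det hy), Fintype.card_fin]
  have hscal : scal G y = 0 := by
    field_simp at trace_ric
    linear_combination -trace_ric
  rw [hric, hscal, zero_div, zero_mul]

theorem cotton_and_weylRic_eq_zero_of_pd_eq_zero (h : IsStaticOn U G u) (hn : n ≠ 1)
    (hu : ∀ x ∈ U, u x ≠ 0) (hp : ∀ x ∈ U, ∀ i, pd i u x = 0) (hy : y ∈ U) :
    (∀ i j k, cotton G i j k y = 0) ∧ ∀ i j, weylRic G i j y = 0 := by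
  have hric : ∀ j k, Set.EqOn (ric G j k) (fun _ => 0) U := fun j k x hx =>
    h.ric_eq_zero_of_pd_eq_zero hn hp hx (hu x hx) j k
  have hscal : Set.EqOn (scal G) (fun _ => 0) U := fun x hx => by
    simp [scal, hric _ _ hx]
  have cov2_ric (i j k : Fin n) : cov2 G (ric G) i j k y = 0 := by
    simp [cov2, pd_congr h.isOpen (hric j k) hy, pd_const, hric _ _ hy]
  refine ⟨fun i j k => ?_, fun i j => ?_⟩
  · simp [cotton, cov2_ric, pd_congr h.isOpen hscal hy, pd_const]
  · simp [weylRic, hric _ _ hy]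

theorem subset_closure_cotton_and_weylRic_eq_zero (h : IsStaticOn U G u) (hn : 3 ≤ n)
    (hu : U ⊆ closure {x ∈ U | u x ≠ 0}) (hT : ∀ x ∈ U, ∀ i j k, tensorT G u i j k x = 0) :
    U ⊆ closure {x ∈ U | (∀ i j k, cotton G i j k x = 0) ∧ ∀ i j, weylRic G i j x = 0} := by
  refine hu.trans (closure_minimal (fun x ⟨hx, hux⟩ => ?_) isClosed_closure)
  set D := {x ∈ U | u x ≠ 0 ∧ (pd · u x) ≠ 0}
  by_cases hxD : x ∈ closure D
  · refine (closure_mono ?_ : closure D ⊆ _) hxD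
    intro z ⟨hz, huz, hpz⟩
    exact ⟨hz, h.cotton_and_weylRic_eq_zero_of_pd_ne_zero hn hT hz huz hpz⟩
  · have hV : IsOpen ((U ∩ u ⁻¹' {0}ᶜ) ∩ (closure D)ᶜ) :=
      (h.smooth_fun.continuousOn.isOpen_inter_preimage h.isOpen
        isOpen_compl_singleton).inter isClosed_closure.isOpen_compl
    have hpV : ∀ z ∈ (U ∩ u ⁻¹' {0}ᶜ) ∩ (closure D)ᶜ, ∀ i, pd i u z = 0 := fun z hz =>
      congrFun (not_not.mp fun hne => hz.2 (subset_closure ⟨hz.1.1, hz.1.2, hne⟩))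
    exact subset_closure ⟨hx, (h.mono hV fun z hz => hz.1.1)
      |>.cotton_and_weylRic_eq_zero_of_pd_eq_zero (by lia) (fun z hz => hz.1.2) hpV
        ⟨⟨hx, hux⟩, hxD⟩⟩

theorem cotton_eq_zero (h : IsStaticOn U G u) (hn : 3 ≤ n)
    (hu : U ⊆ closure {x ∈ U | u x ≠ 0}) (hT : ∀ x ∈ U, ∀ i j k, tensorT G u i j k x = 0)
    (i j k : Fin n) : ∀ x ∈ U, cotton G i j k x = 0 :=
  Set.EqOn.of_subset_closure (fun _ hx => hx.2.1 i j k) (h.smooth_cotton i j k).continuousOn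
    continuousOn_const (Set.sep_subset _ _)
    (h.subset_closure_cotton_and_weylRic_eq_zero hn hu hT)

theorem weylRic_eq_zero (h : IsStaticOn U G u) (hn : 3 ≤ n)
    (hu : U ⊆ closure {x ∈ U | u x ≠ 0}) (hT : ∀ x ∈ U, ∀ i j k, tensorT G u i j k x = 0)
    (i j : Fin n) : ∀ x ∈ U, weylRic G i j x = 0 :=
  Set.EqOn.of_subset_closure (fun _ hx => hx.2.2 i j) (h.smooth_weylRic hn i j).continuousOn
    continuousOn_const (Set.sep_subset _ _)
    (h.subset_closure_cotton_and_weylRic_eq_zero hn hu hT)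

theorem bach_eq_zero (h : IsStaticOn U G u) (hn : 3 ≤ n)
    (hu : U ⊆ closure {x ∈ U | u x ≠ 0}) (hT : ∀ x ∈ U, ∀ i j k, tensorT G u i j k x = 0)
    (hy : y ∈ U) (i j : Fin n) : bach G i j y = 0 := by
  rw [h.bach_eq_of_cotton_eq_zero hn (h.cotton_eq_zero hn hu hT) hy,
    h.weylRic_eq_zero hn hu hT i j y hy, mul_zero]

end IsStaticOn

/-! ### Unique continuation -/

theorem eq_zero_of_hasDerivAt_linear {E : Type*} [NormedAddCommGroup E] [NormedSpace ℝ E]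
    {f : ℝ → E} {A : ℝ → E →L[ℝ] E} {a b : ℝ} (hA : ContinuousOn A (Set.Icc a b))
    (hf : ∀ t ∈ Set.Icc a b, HasDerivAt f (A t (f t)) t) (ha : f a = 0) :
    ∀ t ∈ Set.Icc a b, f t = 0 := by
  obtain ⟨K, hK⟩ := isCompact_Icc.exists_bound_of_continuousOn hA
  exact eq_zero_of_abs_deriv_le_mul_abs_self_of_eq_zero_right (K := K)
    (fun t ht => (hf t ht).continuousAt.continuousWithinAt)
    (fun t ht => (hf t (Set.Ico_subset_Icc_self ht)).hasDerivWithinAt) ha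
    fun t ht => (A t).le_of_opNorm_le (hK t (Set.Ico_subset_Icc_self ht)) _

theorem fderiv_apply_eq_sum (F : Coord n → ℝ) (x v : Coord n) :
    fderiv ℝ F x v = ∑ i, v i * pd i F x := by
  conv_lhs => rw [← (EuclideanSpace.basisFun (Fin n) ℝ).sum_repr v]
  simp [pd]

theorem eq_zero_of_pd_eq_mulVec {κ : Type*} [Fintype κ] {w : κ → Coord n → ℝ}
    {A : Fin n → Coord n → Matrix κ κ ℝ} {x z : Coord n} (hxz : segment ℝ x z ⊆ U)
    (hA : ∀ i a b, ContinuousOn (fun y => A i y a b) U)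
    (hdiff : ∀ a, ∀ y ∈ U, DifferentiableAt ℝ (w a) y)
    (hw : ∀ i a, ∀ y ∈ U, pd i (w a) y = (A i y *ᵥ (w · y)) a) (hx : ∀ a, w a x = 0) (a : κ) :
    w a z = 0 := by
  set γ : ℝ → Coord n := fun t => AffineMap.lineMap x z t
  set L : ℝ → (κ → ℝ) →L[ℝ] κ → ℝ := fun t =>
    ∑ i, (z - x) i • (A i (γ t)).mulVecLin.toContinuousLinearMap
  have hγ : Set.MapsTo γ (Set.Icc 0 1) U := fun t ht => hxz (by
    rw [segment_eq_image_lineMap]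
    exact ⟨t, ht, rfl⟩)
  have hL : ContinuousOn L (Set.Icc 0 1) := by
    refine continuousOn_finsetSum _ fun i _ => ContinuousOn.fun_const_smul ?_ _
    refine continuousOn_clm_apply.mpr fun v => continuousOn_pi.mpr fun a => ?_
    exact continuousOn_finsetSum _ fun b _ =>
      ((hA i a b).comp AffineMap.lineMap_continuous.continuousOn hγ).mul continuousOn_const
  have hderiv : ∀ t ∈ Set.Icc (0 : ℝ) 1,
      HasDerivAt (fun t a => w a (γ t)) (L t fun a => w a (γ t)) t := fun t ht => by
    refine hasDerivAt_pi.mpr fun a => ?_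
    refine ((hdiff a _ (hγ ht)).hasFDerivAt.comp_hasDerivAt t
      AffineMap.hasDerivAt_lineMap).congr_deriv ?_
    rw [fderiv_apply_eq_sum]
    simp [L, hw _ a _ (hγ ht)]
  have := eq_zero_of_hasDerivAt_linear hL hderiv (by simp [γ, hx, funext_iff]) 1 (by simp)
  simpa [γ] using congrFun this a

/-- The `1`-jet `(u, ∂₁ u, …, ∂ₙ u)`, indexed by `Option (Fin n)`. -/
noncomputable def jet (u : Coord n → ℝ) : Option (Fin n) → Coord n → ℝ
  | none => u
  | some j => pd j u

/-- The coefficients of the linear first-order system satisfied by the `1`-jet of a solution of the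
vacuum static equation. -/
noncomputable def jetMatrix (G : CoordMetric n) (i : Fin n) (y : Coord n) :
    Matrix (Option (Fin n)) (Option (Fin n)) ℝ
  | none, none => 0
  | none, some m => if m = i then 1 else 0
  | some j, none => ric G i j y - scal G y / ((n : ℝ) - 1) * G y i j
  | some j, some m => christoffel G m i j y

theorem IsMetricOn.continuousOn_jetMatrix (h : IsMetricOn U G) (i : Fin n) :
    ∀ a b, ContinuousOn (fun x => jetMatrix G i x a b) U
  | none, none => continuousOn_const
  | none, some _ => continuousOn_const
  | some j, none =>
    ((h.smooth_ric i j).sub ((h.smooth_scal.div_const _).mul (h.smooth i j))).continuousOn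
  | some j, some m => (h.smooth_christoffel m i j).continuousOn

namespace IsStaticOn

theorem differentiableAt_jet (h : IsStaticOn U G u) (hy : y ∈ U) :
    ∀ a, DifferentiableAt ℝ (jet u a) y
  | none => h.smooth_fun.differentiableAt h.isOpen hy
  | some j => (h.smooth_fun.pd_of_isOpen h.isOpen j).differentiableAt h.isOpen hy

theorem pd_jet (h : IsStaticOn U G u) (hy : y ∈ U) (i : Fin n) :
    ∀ a, pd i (jet u a) y = (jetMatrix G i y *ᵥ (jet u · y)) a
  | none => by simp [mulVec, dotProduct, jet, jetMatrix]
  | some j => by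
    have := h.static y hy i j
    rw [hess, cov1, sub_eq_iff_eq_add] at this
    simpa [mulVec, dotProduct, jet, jetMatrix] using this

theorem eq_zero_of_eventuallyEq_zero (h : IsStaticOn U G u) (hU : Convex ℝ U) {x : Coord n}
    (hx : x ∈ U) (hu : u =ᶠ[𝓝 x] 0) (hy : y ∈ U) : u y = 0 := by
  have jet_eq_zero : ∀ a, jet u a x = 0
    | none => hu.eq_of_nhds
    | some j => by simp [jet, pd, hu.fderiv_eq]
  exact eq_zero_of_pd_eq_mulVec (hU.segment_subset hx hy) h.continuousOn_jetMatrix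
    (fun a _ hz => h.differentiableAt_jet hz a) (fun i a _ hz => h.pd_jet hz i a) jet_eq_zero none

end IsStaticOn

/-! ### Passage to charts -/

section Charts

variable {M : Type*} [TopologicalSpace M] [ChartedSpace (Coord n) M]
  {e : OpenPartialHomeomorph M (Coord n)}

theorem sum_smul_coordVec (e : OpenPartialHomeomorph M (Coord n)) (y : Coord n) (x : Fin n → ℝ) :
    ∑ i, x i • coordVec e i y
      = mfderiv (𝓡 n) (𝓡 n) e.symm y (WithLp.toLp 2 x : Coord n) := by
  have : (WithLp.toLp 2 x : Coord n) = ∑ i, x i • (EuclideanSpace.single i 1 : Coord n) := by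
    simpa using ((EuclideanSpace.basisFun (Fin n) ℝ).sum_repr (WithLp.toLp 2 x)).symm
  rw [this]
  refine Eq.symm ((map_sum (mfderiv (𝓡 n) (𝓡 n) e.symm y) _ _).trans ?_)
  exact Finset.sum_congr rfl fun i _ => map_smul _ _ _

theorem mfderiv_symm_injective (he : e ∈ IsManifold.maximalAtlas (𝓡 n) ∞ M) (hy : y ∈ e.target) :
    Function.Injective (mfderiv (𝓡 n) (𝓡 n) e.symm y) := by
  have hdiff : e.MDifferentiable (𝓡 n) (𝓡 n) :=
    ⟨(contMDiffOn_of_mem_maximalAtlas he).mdifferentiableOn (by simp),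
      (contMDiffOn_symm_of_mem_maximalAtlas he).mdifferentiableOn (by simp)⟩
  exact hdiff.symm.mfderiv_injective hy

variable [IsManifold (𝓡 n) ∞ M]

theorem contMDiffOn_coordVec (he : e ∈ IsManifold.maximalAtlas (𝓡 n) ∞ M) (i : Fin n) :
    ContMDiffOn (𝓡 n) (𝓡 n).tangent ∞
      (fun y => (⟨e.symm y, coordVec e i y⟩ : TangentBundle (𝓡 n) M)) e.target := by
  have htangent := (contMDiffOn_symm_of_mem_maximalAtlas he).contMDiffOn_tangentMapWithin (m := ∞)
    (by simp) e.open_target.uniqueMDiffOn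
  have hsingle : ContMDiff (𝓡 n) (𝓡 n).tangent ∞ (fun y : Coord n =>
      (⟨y, (EuclideanSpace.single i 1 : Coord n)⟩ : TangentBundle (𝓡 n) (Coord n))) :=
    contMDiff_vectorSpace_iff_contDiff.mpr contDiff_const
  refine (htangent.comp hsingle.contMDiffOn (fun y hy => hy)).congr fun y hy => ?_
  simp only [Function.comp, tangentMapWithin, coordVec, mfderivWithin_of_isOpen e.open_target hy]

theorem smoothMatrixOn_metricIn (g : Metric n M) (he : e ∈ IsManifold.maximalAtlas (𝓡 n) ∞ M) :
    SmoothMatrixOn e.target (metricIn g e) := by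
  intro a b
  have smooth_section : ContMDiffOn (𝓡 n) ((𝓡 n).prod 𝓘(ℝ)) ∞
      (fun y => TotalSpace.mk' ℝ (E := Bundle.Trivial M ℝ) (e.symm y)
        (g.inner (e.symm y) (coordVec e a y) (coordVec e b y))) e.target := by
    apply ContMDiffOn.clm_bundle_apply₂ (F₁ := Coord n) (F₂ := Coord n)
    · exact g.contMDiff.comp_contMDiffOn (contMDiffOn_symm_of_mem_maximalAtlas he)
    · exact contMDiffOn_coordVec he a
    · exact contMDiffOn_coordVec he b
  intro y hy
  have := smooth_section y hy
  simp only [contMDiffWithinAt_totalSpace] at this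
  exact this.2.contDiffWithinAt

theorem posDef_metricIn (g : Metric n M) (he : e ∈ IsManifold.maximalAtlas (𝓡 n) ∞ M)
    (hy : y ∈ e.target) : (metricIn g e y).PosDef := by
  refine PosDef.of_dotProduct_mulVec_pos (Matrix.ext fun i j => g.symm _ _ _) fun x hx => ?_
  have hne : ∑ i, x i • coordVec e i y ≠ 0 := by
    rw [sum_smul_coordVec]
    intro h
    exact hx (congrArg WithLp.ofLp (mfderiv_symm_injective he hy (h.trans (map_zero _).symm)))
  refine (g.pos _ _ hne).trans_eq ?_
  simp only [map_sum, map_smul, _root_.sum_apply, _root_.smul_apply, dotProduct, mulVec, metricIn,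
    Matrix.of_apply, Pi.star_apply, star_trivial, smul_eq_mul, Finset.mul_sum]
  rw [Finset.sum_comm]
  exact Finset.sum_congr rfl fun i _ => Finset.sum_congr rfl fun j _ => by ring

theorem isMetricOn_metricIn (g : Metric n M) (he : e ∈ IsManifold.maximalAtlas (𝓡 n) ∞ M) :
    IsMetricOn e.target (metricIn g e) :=
  ⟨e.open_target, smoothMatrixOn_metricIn g he, fun _ hy => posDef_metricIn g he hy⟩

namespace IsVacuumStatic

variable {g : Metric n M} {f : M → ℝ}

theorem isStaticOn_chart (hf : IsVacuumStatic g f) (he : e ∈ IsManifold.maximalAtlas (𝓡 n) ∞ M) :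
    IsStaticOn e.target (metricIn g e) (funIn f e) where
  toIsMetricOn := isMetricOn_metricIn g he
  smooth_fun := contMDiffOn_iff_contDiffOn.mp
    (hf.smooth.comp_contMDiffOn (contMDiffOn_symm_of_mem_maximalAtlas he))
  static y hy i j := sub_eq_zero.mp (hf.static e he y hy i j)

theorem isClosed_eventuallyEq_zero (hf : IsVacuumStatic g f) :
    IsClosed {x | f =ᶠ[𝓝 x] 0} := by
  refine isClosed_of_closure_subset fun x hx => ?_
  set e := chartAt (Coord n) x
  have hxe : x ∈ e.source := mem_chart_source _ x
  obtain ⟨ε, hε, hball⟩ := Metric.isOpen_iff.mp e.open_target (e x) (e.map_source hxe)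
  have hB : IsStaticOn (Metric.ball (e x) ε) (metricIn g e) (funIn f e) :=
    (hf.isStaticOn_chart (IsManifold.chart_mem_maximalAtlas x)).mono Metric.isOpen_ball hball
  have hV : e.source ∩ e ⁻¹' Metric.ball (e x) ε ∈ 𝓝 x :=
    (e.isOpen_inter_preimage Metric.isOpen_ball).mem_nhds ⟨hxe, Metric.mem_ball_self hε⟩
  obtain ⟨x₀, ⟨hx₀, hx₀B⟩, hfx₀⟩ := mem_closure_iff_nhds.mp hx _ hV
  have hfe : funIn f e =ᶠ[𝓝 (e x₀)] 0 :=
    (e.tendsto_symm hx₀).eventually hfx₀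
  filter_upwards [hV] with z hz
  have := hB.eq_zero_of_eventuallyEq_zero (convex_ball _ _) hx₀B hfe hz.2
  rwa [funIn, e.left_inv hz.1] at this

theorem dense_ne_zero [ConnectedSpace M] (hf : IsVacuumStatic g f) : Dense {x | f x ≠ 0} := by
  have hclopen : IsClopen {x | f =ᶠ[𝓝 x] 0} :=
    ⟨hf.isClosed_eventuallyEq_zero, isOpen_setOfPred_eventually_nhds⟩
  have hempty : {x | f =ᶠ[𝓝 x] 0} = ∅ := (isClopen_iff.mp hclopen).resolve_right fun huniv =>
    let ⟨x, hx⟩ := hf.nontrivial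
    hx (Set.eq_univ_iff_forall.mp huniv x).eq_of_nhds
  refine fun x => mem_closure_iff_frequently.mpr fun hx =>
    Set.eq_empty_iff_forall_notMem.mp hempty x ?_
  exact hx.mono fun z => not_not.mp

theorem target_subset_closure_funIn_ne_zero [ConnectedSpace M] (hf : IsVacuumStatic g f)
    (e : OpenPartialHomeomorph M (Coord n)) :
    e.target ⊆ closure {y ∈ e.target | funIn f e y ≠ 0} := by
  have := e.symm.preimage_closure {x | f x ≠ 0}
  rw [hf.dense_ne_zero.closure_eq, Set.preimage_univ, Set.inter_univ] at this
  exact this.le.trans e.open_target.inter_closure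

end IsVacuumStatic

end Charts

end StaticSpace

theorem proposition4_general {n : ℕ} (hn : 3 ≤ n) {M : Type*} [TopologicalSpace M]
    [ChartedSpace (StaticSpace.Coord n) M] [IsManifold (𝓡 n) ∞ M] [ConnectedSpace M]
    (g : StaticSpace.Metric n M) (f : M → ℝ) (hf : StaticSpace.IsVacuumStatic g f)
    (hT : StaticSpace.TensorTVanishes g f) :
    StaticSpace.BachVanishes g ∧ StaticSpace.CottonVanishes g := by
  have hdense := hf.target_subset_closure_funIn_ne_zero
  constructor
  · intro e he y hy
    exact (hf.isStaticOn_chart he).bach_eq_zero hn (hdense e) (hT e he) hy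
  · intro e he y hy i j k
    exact (hf.isStaticOn_chart he).cotton_eq_zero hn (hdense e) (hT e he) i j k y hy

theorem proposition4 {n : ℕ} (hn : 3 ≤ n) {M : Type*} [TopologicalSpace M]
    [ChartedSpace (StaticSpace.Coord n) M] [IsManifold (𝓡 n) ∞ M] [ConnectedSpace M]
    (g : StaticSpace.Metric n M) (f : M → ℝ) (hf : StaticSpace.IsVacuumStatic g f)
    (hB : StaticSpace.DivDivBachVanishes g) (hT : StaticSpace.TensorTVanishes g f) :
    StaticSpace.BachVanishes g ∧ StaticSpace.CottonVanishes g :=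
  proposition4_general hn g f hf hT
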